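/- Let $\boldsymbol{\mathit{ba}\ell}$ be the category of bounded archimedean $\ell$-algebras (commutative unital lattice-ordered $\mathbb R$-algebras $A$ such that every $a\in A$ satisfies $a\le n\cdot 1$ for some $n\in\mathbb N$, and such that $n\cdot a\le b$ for all $n\in\mathbb N$ implies $a\le 0$) with unital $\ell$-algebra morphisms (unital $\mathbb R$-algebra homomorphisms that are lattice homomorphisms). Put $\|a\|=\inf\{r\in\mathbb R : |a|\le r\cdot 1\}$ (read as $0$ in the zero algebra), and let $\boldsymbol{\mathit{uba}\ell}$ be the full subcategory of those $A$ whose norm is complete. For $A\in\boldsymbol{\mathit{ba}\ell}$ let $f_A:A\to F(A)$ be the free object of $\boldsymbol{\mathit{ba}\ell}$ on the weighted set $(A,w_A)$, $w_A(a)=\max\{\|a\|,1\}$; that is, $\|f_A(a)\|\le w_A(a)$ for all $a$, and every map $v:A\to B$ into some $B\in\boldsymbol{\mathit{ba}\ell}$ with $\|v(a)\|\le w_A(a)$ for all $a$ factors as $v=\varphi\circ f_A$ for a unique morphism $\varphi:F(A)\to B$. An $\ell$-ideal is an ideal $I$ such that $|a|\le|b|$ and $b\in I$ imply $a\in I$;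 it is archimedean if the quotient by it is archimedean. Let $I_A$ be the least archimedean $\ell$-ideal of $F(A)$ containing, for all $a,b\in A$, $r\in\mathbb R$, the elements $f_A(a\wedge b)-f_A(a)\wedge f_A(b)$, $f_A(r)-r-(1-r)f_A(0)$, $f_A(a^+)-f_A(a)^+$, $f_A(a+r)-f_A(a)-f_A(r)+f_A(0)$, and, if $r\ge 0$, $f_A(ra)-f_A(r)f_A(a)$, where $a^+=a\vee 0$. Let $H(A)=F(A)/I_A$ and let $h_A:A\to H(A)$ be the map induced by $f_A$; for a morphism $\alpha:A\to B$, $H(\alpha)$ is the unique morphism with $H(\alpha)\circ h_A=h_B\circ\alpha$. This makes $H$ an endofunctor of $\boldsymbol{\mathit{ba}\ell}$. Let $Y(A)=Y_A$ be the compact Hausdorff space of maximal $\ell$-ideals of $A$, whose closed sets are the sets $\{M : I\subseteq M\}$ for $\ell$-ideals $I$, with $Y(\alpha)=\alpha^{-1}$; let $C(X)$ be the algebra of continuous real-valued functions on a compact Hausdorff space $X$, with $C(\varphi)(f)=f\circ\varphi$; and let $\zeta_A:A\to C(Y_A)$ be the uniform completion, where $\zeta_A(a)(M)$ is the unique $r\in\mathbb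 R$ with $a-r\in M$. Let $H^u=C\circ Y\circ H$, an endofunctor of $\boldsymbol{\mathit{uba}\ell}$. For an endofunctor $T$ let $\mathsf{Alg}(T)$ be the category of pairs $(A,\alpha)$ with $\alpha:T(A)\to A$, whose morphisms $(A,\alpha)\to(A',\alpha')$ are the morphisms $\gamma:A\to A'$ with $\gamma\circ\alpha=\alpha'\circ T(\gamma)$. Let $\mathsf{Alg}^u(H)$ be the full subcategory of $\mathsf{Alg}(H)$ of those $(A,\alpha)$ with $A\in\boldsymbol{\mathit{uba}\ell}$. **Proposition.** The categories $\mathsf{Alg}^u(H)$ and $\mathsf{Alg}(H^u)$ are isomorphic. More precisely, for every $A\in\boldsymbol{\mathit{uba}\ell}$ and every morphism $\alpha:H(A)\to A$ there is a unique morphism $\alpha^u:C(Y_{H(A)})\to A$ with $\alpha^u\circ\zeta_{H(A)}=\alpha$, and there are mutually inverse functors $\mathsf{Alg}^u(H)\to\mathsf{Alg}(H^u)$, $(A,\alpha)\mapsto(A,\alpha^u)$, and $\mathsf{Alg}(H^u)\to\mathsf{Alg}^u(H)$, $(A,\beta)\mapsto(A,\beta\circ\zeta_{H(A)})$, both sending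 each morphism $\gamma$ to $\gamma$ itself. -/

import Mathlib

open CategoryTheory

universe u

namespace Bal

/-! ### Lattice-ordered rings and algebras -/

/-- `ℓ`-rings (commutative and unital). -/
class IsLRing (A : Type*) [CommRing A] [Lattice A] : Prop where
  add_le_add_right' : ∀ a b c : A, a ≤ b → a + c ≤ b + c
  mul_nonneg' : ∀ a b : A, 0 ≤ a → 0 ≤ b → 0 ≤ a * b

/-- `ℓ`-algebras over `ℝ`. -/
class IsLAlgebra (A : Type*) [CommRing A] [Lattice A] [Algebra ℝ A] : Prop
    extends IsLRing A where
  smul_nonneg' : ∀ (r : ℝ) (a : A), 0 ≤ r → 0 ≤ a → 0 ≤ r • a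

/-- The unit is a strong order unit. -/
def IsLBounded (A : Type*) [CommRing A] [Lattice A] : Prop :=
  ∀ a : A, ∃ n : ℕ, a ≤ n • (1 : A)

/-- The archimedean property of an `ℓ`-ring. -/
def IsLArchimedean (A : Type*) [CommRing A] [Lattice A] : Prop :=
  ∀ a b : A, (∀ n : ℕ, n • a ≤ b) → a ≤ 0

/-- Bounded archimedean `ℓ`-algebras. -/
class IsBal (A : Type*) [CommRing A] [Lattice A] [Algebra ℝ A] : Prop
    extends IsLAlgebra A where
  bounded : IsLBounded A
  archimedean : IsLArchimedean A

/-- Unital `ℓ`-algebra morphisms: unital `ℝ`-algebra homomorphisms preserving `⊔` and `⊓`. -/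
structure BalHom (A B : Type*) [CommRing A] [Lattice A] [Algebra ℝ A]
    [CommRing B] [Lattice B] [Algebra ℝ B] extends A →ₐ[ℝ] B where
  map_sup' : ∀ a b : A, toFun (a ⊔ b) = toFun a ⊔ toFun b
  map_inf' : ∀ a b : A, toFun (a ⊓ b) = toFun a ⊓ toFun b

/-- The norm `‖a‖ = inf {r | |a| ≤ r • 1}`. In the zero algebra, where the set on the right is all
of `ℝ`, it takes the value `0`. -/
noncomputable def lnorm {A : Type*} [CommRing A] [Lattice A] [Algebra ℝ A] (a : A) : ℝ :=
  sInf {r : ℝ | |a| ≤ r • (1 : A)}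

/-- The norm is complete: Cauchy sequences for the norm converge in the norm. -/
def IsUniformlyComplete (A : Type*) [CommRing A] [Lattice A] [Algebra ℝ A] : Prop :=
  ∀ s : ℕ → A, (∀ ε : ℝ, 0 < ε → ∃ N, ∀ m ≥ N, ∀ n ≥ N, lnorm (s m - s n) < ε) →
    ∃ a : A, ∀ ε : ℝ, 0 < ε → ∃ N, ∀ n ≥ N, lnorm (s n - a) < ε

section LRing

variable {A : Type*} [CommRing A] [Lattice A]

instance (priority := 50) IsLRing.isOrderedAddMonoid [IsLRing A] : IsOrderedAddMonoid A where
  add_le_add_left a b h c := IsLRing.add_le_add_right' a b c h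

lemma mul_nn [IsLRing A] {a b : A} (ha : 0 ≤ a) (hb : 0 ≤ b) : 0 ≤ a * b :=
  IsLRing.mul_nonneg' a b ha hb

lemma half_nn [IsLRing A] {a : A} (h : 0 ≤ a + a) : 0 ≤ a :=
  nsmul_two_semiclosed (by rwa [two_nsmul])

lemma abs_mul_le [IsLRing A] (a b : A) : |a * b| ≤ |a| * |b| := by
  have a1 : 0 ≤ |a| - a := sub_nonneg.2 (le_abs_self a)
  have a2 : 0 ≤ |a| + a := by have := sub_nonneg.2 (neg_le_abs a); simpa using this
  have b1 : 0 ≤ |b| - b := sub_nonneg.2 (le_abs_self b)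
  have b2 : 0 ≤ |b| + b := by have := sub_nonneg.2 (neg_le_abs b); simpa using this
  apply abs_le'.2 ⟨?_, ?_⟩
  · apply sub_nonneg.1
    apply half_nn
    have := add_nonneg (mul_nn a1 b2) (mul_nn a2 b1)
    convert this using 1
    ring
  · apply sub_nonneg.1
    apply half_nn
    have := add_nonneg (mul_nn a1 b1) (mul_nn a2 b2)
    convert this using 1
    ring

lemma abs_nsmul_le [IsLRing A] (n : ℕ) (a : A) : |n • a| ≤ n • |a| := by
  induction n with
  | zero => simp [abs]
  | succ k ih =>
    rw [succ_nsmul, succ_nsmul]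
    exact (abs_add_le _ _).trans (add_le_add_left ih _)

end LRing

section LAlgebra

variable {A : Type*} [CommRing A] [Lattice A] [Algebra ℝ A]

lemma smul_nn [IsLAlgebra A] {r : ℝ} {a : A} (hr : 0 ≤ r) (ha : 0 ≤ a) : 0 ≤ r • a :=
  IsLAlgebra.smul_nonneg' r a hr ha

lemma smul_mono [IsLAlgebra A] {r : ℝ} {a b : A} (hr : 0 ≤ r) (h : a ≤ b) : r • a ≤ r • b := by
  apply sub_nonneg.1
  rw [← smul_sub]
  exact smul_nn hr (sub_nonneg.2 h)

lemma nsmul_one_eq {A : Type*} [CommRing A] [Algebra ℝ A] (n : ℕ) : n • (1 : A) = (n : ℝ) • (1 : A) := (Nat.cast_smul_eq_nsmul ℝ n 1).symm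

lemma one_nn [IsLAlgebra A] (hb : IsLBounded A) : (0 : A) ≤ 1 := by
  obtain ⟨n, hn⟩ := hb |1|
  have h0 : (0 : A) ≤ n • (1 : A) := (abs_nonneg _).trans hn
  rcases Nat.eq_zero_or_pos n with rfl | hpos
  · have h1 : |(1 : A)| ≤ 0 := by simpa using hn
    exact (neg_nonneg.2 ((neg_le_abs (1 : A)).trans h1) |> fun h => by simpa using h)
  · have := smul_nn (r := (n : ℝ)⁻¹) (by positivity) h0
    rwa [nsmul_one_eq, smul_smul, inv_mul_cancel₀ (by positivity), one_smul] at this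

lemma smul_one_mono [IsLAlgebra A] (hb : IsLBounded A) {r s : ℝ} (h : r ≤ s) :
    r • (1 : A) ≤ s • (1 : A) := by
  apply sub_nonneg.1
  rw [← sub_smul]
  exact smul_nn (sub_nonneg.2 h) (one_nn hb)

lemma norm_set_nonempty [IsLAlgebra A] (hb : IsLBounded A) (a : A) :
    {r : ℝ | |a| ≤ r • (1 : A)}.Nonempty := by
  obtain ⟨n, hn⟩ := hb |a|
  exact ⟨n, by rw [nsmul_one_eq] at hn; exact hn⟩

lemma nonneg_of_le_smul_one [IsLAlgebra A] [Nontrivial A] (hb : IsLBounded A) {a : A} {r : ℝ}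
    (h : |a| ≤ r • (1 : A)) : 0 ≤ r := by
  by_contra hr
  push Not at hr
  have h1 : (0 : A) ≤ r • (1 : A) := (abs_nonneg _).trans h
  have h2 : r • (1 : A) ≤ (0 : ℝ) • (1 : A) := smul_one_mono hb hr.le
  rw [zero_smul] at h2
  have h3 : r • (1 : A) = 0 := le_antisymm h2 h1
  rcases smul_eq_zero.1 h3 with h | h
  · exact hr.ne h
  · exact one_ne_zero h

lemma lnorm_of_subsingleton [Subsingleton A] (a : A) : lnorm a = 0 := by
  have : {r : ℝ | |a| ≤ r • (1 : A)} = Set.univ := by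
    ext r
    simp only [Set.mem_ofPred_eq, Set.mem_univ, iff_true]
    exact (Subsingleton.elim _ _).le
  rw [lnorm, this, Real.sInf_univ]

lemma lnorm_nonneg [IsLAlgebra A] (hb : IsLBounded A) (a : A) : 0 ≤ lnorm a := by
  rcases subsingleton_or_nontrivial A with h | h
  · rw [lnorm_of_subsingleton]
  · exact Real.sInf_nonneg fun r hr => nonneg_of_le_smul_one hb hr

lemma lnorm_le_of [IsLAlgebra A] (hb : IsLBounded A) {a : A} {r : ℝ} (hr : 0 ≤ r)
    (h : |a| ≤ r • (1 : A)) : lnorm a ≤ r := by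
  rcases subsingleton_or_nontrivial A with _ | _
  · rwa [lnorm_of_subsingleton]
  · exact csInf_le ⟨0, fun s hs => nonneg_of_le_smul_one hb hs⟩ h

lemma abs_le_of_lnorm_lt [IsLAlgebra A] (hb : IsLBounded A) {a : A} {r : ℝ} (h : lnorm a < r) :
    |a| ≤ r • (1 : A) := by
  obtain ⟨s, hs, hsr⟩ := exists_lt_of_csInf_lt (norm_set_nonempty hb a) h
  exact le_trans hs (smul_one_mono hb hsr.le)

end LAlgebra

namespace BalHom

variable {A B C : Type*} [CommRing A] [Lattice A] [Algebra ℝ A]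
  [CommRing B] [Lattice B] [Algebra ℝ B] [CommRing C] [Lattice C] [Algebra ℝ C]

instance : FunLike (BalHom A B) A B where
  coe f := f.toFun
  coe_injective f g h := by
    rcases f with ⟨f, _, _⟩
    rcases g with ⟨g, _, _⟩
    have : f = g := AlgHom.ext fun x => congrFun h x
    subst this
    rfl

instance : AlgHomClass (BalHom A B) ℝ A B where
  map_mul f := map_mul f.toAlgHom
  map_one f := map_one f.toAlgHom
  map_add f := map_add f.toAlgHom
  map_zero f := map_zero f.toAlgHom
  commutes f := f.toAlgHom.commutes

instance : LatticeHomClass (BalHom A B) A B where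
  map_sup f := f.map_sup'
  map_inf f := f.map_inf'

lemma ext {f g : BalHom A B} (h : ∀ a, f a = g a) : f = g := DFunLike.ext f g h

/-- The identity morphism. -/
protected def id (A : Type*) [CommRing A] [Lattice A] [Algebra ℝ A] : BalHom A A :=
  { AlgHom.id ℝ A with
    map_sup' := fun _ _ => rfl
    map_inf' := fun _ _ => rfl }

/-- Composition of morphisms. -/
protected def comp (g : BalHom B C) (f : BalHom A B) : BalHom A C :=
  { g.toAlgHom.comp f.toAlgHom with
    map_sup' := fun a b => by
      change g (f (a ⊔ b)) = g (f a) ⊔ g (f b)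
      rw [map_sup, map_sup]
    map_inf' := fun a b => by
      change g (f (a ⊓ b)) = g (f a) ⊓ g (f b)
      rw [map_inf, map_inf] }

lemma map_abs (f : BalHom A B) (a : A) : f |a| = |f a| := by
  simp only [abs, map_sup, map_neg]

lemma map_mono (f : BalHom A B) {a b : A} (h : a ≤ b) : f a ≤ f b := by
  have : f (a ⊔ b) = f b := by rw [sup_eq_right.2 h]
  rw [map_sup] at this
  exact sup_eq_right.1 this

lemma map_smul_one (f : BalHom A B) (r : ℝ) : f (r • (1 : A)) = r • (1 : B) := by
  rw [map_smul, map_one]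

lemma lnorm_map_le [IsLAlgebra A] [IsLAlgebra B] (hA : IsLBounded A) (hB : IsLBounded B)
    (f : BalHom A B) (a : A) : lnorm (f a) ≤ lnorm a := by
  refine le_of_forall_gt_imp_ge_of_dense fun r hr => ?_
  apply lnorm_le_of hB ((lnorm_nonneg hA a).trans hr.le)
  rw [← map_abs, ← map_smul_one f]
  exact map_mono f (abs_le_of_lnorm_lt hA hr)

end BalHom

end Bal

/-- The category of bounded archimedean `ℓ`-algebras and unital `ℓ`-algebra morphisms. -/
structure BAL : Type (u + 1) where
  /-- The underlying type. -/
  carrier : Type u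
  [commRing : CommRing carrier]
  [lattice : Lattice carrier]
  [algebra : Algebra ℝ carrier]
  [isBal : Bal.IsBal carrier]

namespace BAL

instance : CoeSort BAL.{u} (Type u) := ⟨BAL.carrier⟩

attribute [instance] BAL.commRing BAL.lattice BAL.algebra BAL.isBal

/-- Morphisms in `BAL`. -/
@[ext]
structure Hom (A B : BAL.{u}) where
  /-- The underlying unital `ℓ`-algebra morphism. -/
  hom : Bal.BalHom A B

instance : Category BAL.{u} where
  Hom A B := Hom A B
  id A := ⟨Bal.BalHom.id A⟩
  comp f g := ⟨g.hom.comp f.hom⟩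

lemma hom_ext {A B : BAL.{u}} {f g : A ⟶ B} (h : ∀ a, f.hom a = g.hom a) : f = g :=
  Hom.ext (Bal.BalHom.ext h)

lemma comp_hom_apply {A B C : BAL.{u}} (f : A ⟶ B) (g : B ⟶ C) (a : A) :
    (f ≫ g).hom a = g.hom (f.hom a) := rfl

end BAL

set_option linter.unusedSectionVars false
set_option linter.overlappingInstances false

namespace Bal

/-! ### `ℓ`-ideals and quotients -/

/-- `ℓ`-ideals: ring ideals `I` such that `|a| ≤ |b|` and `b ∈ I` imply `a ∈ I`. -/
structure LIdeal (A : Type*) [CommRing A] [Lattice A] where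
  /-- The underlying ring ideal. -/
  toIdeal : Ideal A
  solid : ∀ a b : A, |a| ≤ |b| → b ∈ toIdeal → a ∈ toIdeal

section Ideals

variable {A : Type*} [CommRing A] [Lattice A]

lemma LIdeal.ext' {I J : LIdeal A} (h : I.toIdeal = J.toIdeal) : I = J := by
  cases I
  cases J
  cases h
  rfl

lemma LIdeal.abs_mem [IsLRing A] (I : LIdeal A) {a : A} (h : a ∈ I.toIdeal) : |a| ∈ I.toIdeal :=
  I.solid _ a (by rw [abs_abs]) h

lemma LIdeal.of_le [IsLRing A] (I : LIdeal A) {a b : A} (h : |a| ≤ b) (hb : b ∈ I.toIdeal) :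
    a ∈ I.toIdeal :=
  I.solid a b (h.trans (le_abs_self b)) hb

/-- The intersection of a set of `ℓ`-ideals. -/
def LIdeal.sInf (T : Set (LIdeal A)) : LIdeal A where
  toIdeal := ⨅ I ∈ T, I.toIdeal
  solid a b h hb := by
    simp only [Submodule.mem_iInf] at hb ⊢
    exact fun I hI => I.solid a b h (hb I hI)

lemma LIdeal.mem_sInf {T : Set (LIdeal A)} {a : A} :
    a ∈ (LIdeal.sInf T).toIdeal ↔ ∀ I ∈ T, a ∈ I.toIdeal := by
  simp [LIdeal.sInf, Submodule.mem_iInf]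

/-- The `ℓ`-ideal generated by a set. -/
def LIdeal.span (S : Set A) : LIdeal A := LIdeal.sInf {I | S ⊆ I.toIdeal}

variable [IsLRing A] (I : LIdeal A)

lemma LIdeal.sup_mem {a b c d : A} (h : a - b ∈ I.toIdeal) (h' : c - d ∈ I.toIdeal) :
    a ⊔ c - b ⊔ d ∈ I.toIdeal := by
  have e : a ⊔ c - b ⊔ d = (a ⊔ c - b ⊔ c) + (c ⊔ b - d ⊔ b) := by
    rw [sup_comm c b, sup_comm d b]
    ring
  rw [e]
  exact add_mem (I.solid _ _ (abs_sup_sub_sup_le_abs a b c) h)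
    (I.solid _ _ (abs_sup_sub_sup_le_abs c d b) h')

lemma LIdeal.inf_mem {a b c d : A} (h : a - b ∈ I.toIdeal) (h' : c - d ∈ I.toIdeal) :
    a ⊓ c - b ⊓ d ∈ I.toIdeal := by
  have e : a ⊓ c - b ⊓ d = (a ⊓ c - b ⊓ c) + (c ⊓ b - d ⊓ b) := by
    rw [inf_comm c b, inf_comm d b]
    ring
  rw [e]
  exact add_mem (I.solid _ _ (abs_inf_sub_inf_le_abs a b c) h)
    (I.solid _ _ (abs_inf_sub_inf_le_abs c d b) h')

/-- The quotient of an `ℓ`-ring by an `ℓ`-ideal. -/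
abbrev LIdeal.Quot : Type _ := A ⧸ I.toIdeal

/-- The quotient map. -/
abbrev LIdeal.proj (a : A) : I.Quot := Ideal.Quotient.mk I.toIdeal a

lemma LIdeal.proj_eq {a b : A} : I.proj a = I.proj b ↔ a - b ∈ I.toIdeal := Ideal.Quotient.eq

lemma LIdeal.proj_nsmul (n : ℕ) (a : A) : I.proj (n • a) = n • I.proj a :=
  map_nsmul (Ideal.Quotient.mk I.toIdeal) n a

lemma LIdeal.proj_surj (x : I.Quot) : ∃ a, I.proj a = x := Ideal.Quotient.mk_surjective x

instance LIdeal.quotMax : Max I.Quot where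
  max x y := Quotient.liftOn₂' x y (fun a b => I.proj (a ⊔ b)) fun _ _ _ _ h h' =>
    I.proj_eq.2 (I.sup_mem ((Submodule.quotientRel_def _).1 h) ((Submodule.quotientRel_def _).1 h'))

instance LIdeal.quotMin : Min I.Quot where
  min x y := Quotient.liftOn₂' x y (fun a b => I.proj (a ⊓ b)) fun _ _ _ _ h h' =>
    I.proj_eq.2 (I.inf_mem ((Submodule.quotientRel_def _).1 h) ((Submodule.quotientRel_def _).1 h'))

lemma LIdeal.proj_sup (a b : A) : I.proj (a ⊔ b) = I.proj a ⊔ I.proj b := rfl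

lemma LIdeal.proj_inf (a b : A) : I.proj (a ⊓ b) = I.proj a ⊓ I.proj b := rfl

/-- The lattice operations of `A ⧸ I` are computed on representatives; the order is
`x ≤ y ↔ x ⊔ y = y`. -/
instance LIdeal.quotLattice : Lattice I.Quot :=
  Lattice.mk'
    (fun x y => by
      obtain ⟨a, rfl⟩ := I.proj_surj x
      obtain ⟨b, rfl⟩ := I.proj_surj y
      rw [← I.proj_sup, ← I.proj_sup, sup_comm])
    (fun x y z => by
      obtain ⟨a, rfl⟩ := I.proj_surj x
      obtain ⟨b, rfl⟩ := I.proj_surj y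
      obtain ⟨c, rfl⟩ := I.proj_surj z
      simp only [← I.proj_sup, sup_assoc])
    (fun x y => by
      obtain ⟨a, rfl⟩ := I.proj_surj x
      obtain ⟨b, rfl⟩ := I.proj_surj y
      rw [← I.proj_inf, ← I.proj_inf, inf_comm])
    (fun x y z => by
      obtain ⟨a, rfl⟩ := I.proj_surj x
      obtain ⟨b, rfl⟩ := I.proj_surj y
      obtain ⟨c, rfl⟩ := I.proj_surj z
      simp only [← I.proj_inf, inf_assoc])
    (fun x y => by
      obtain ⟨a, rfl⟩ := I.proj_surj x
      obtain ⟨b, rfl⟩ := I.proj_surj y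
      rw [← I.proj_inf, ← I.proj_sup, sup_inf_self])
    (fun x y => by
      obtain ⟨a, rfl⟩ := I.proj_surj x
      obtain ⟨b, rfl⟩ := I.proj_surj y
      rw [← I.proj_sup, ← I.proj_inf, inf_sup_self])

lemma LIdeal.proj_sup' (a b : A) : I.proj (a ⊔ b) = I.proj a ⊔ I.proj b := rfl

lemma LIdeal.proj_inf' (a b : A) : I.proj (a ⊓ b) = I.proj a ⊓ I.proj b := rfl

lemma LIdeal.proj_mono {a b : A} (h : a ≤ b) : I.proj a ≤ I.proj b := by
  rw [← sup_eq_right, ← I.proj_sup', sup_eq_right.2 h]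

/-- A relation `x ≤ y` in the quotient lifts to representatives. -/
lemma LIdeal.exists_rep_of_le {x y : I.Quot} (h : x ≤ y) :
    ∃ a b, a ≤ b ∧ I.proj a = x ∧ I.proj b = y := by
  obtain ⟨a, rfl⟩ := I.proj_surj x
  obtain ⟨b, rfl⟩ := I.proj_surj y
  exact ⟨a, a ⊔ b, le_sup_left, rfl, by rw [I.proj_sup', sup_eq_right.2 h]⟩

lemma LIdeal.proj_le_mk_iff {a b : A} : I.proj a ≤ I.proj b ↔ ∃ c ∈ I.toIdeal, a ≤ b + c := by
  constructor
  · intro h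
    refine ⟨a ⊔ b - b, ?_, by simp⟩
    rw [← I.proj_eq, I.proj_sup', sup_eq_right.2 h]
  · rintro ⟨c, hc, h⟩
    have : I.proj (b + c) = I.proj b := I.proj_eq.2 (by simpa using hc)
    rw [← this]
    exact I.proj_mono h

instance LIdeal.quotIsLRing : IsLRing I.Quot where
  add_le_add_right' x y z h := by
    obtain ⟨a, b, hab, rfl, rfl⟩ := I.exists_rep_of_le h
    obtain ⟨c, rfl⟩ := I.proj_surj z
    change I.proj (a + c) ≤ I.proj (b + c)
    exact I.proj_mono (add_le_add_left hab c)
  mul_nonneg' x y hx hy := by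
    have key : ∀ z : I.Quot, 0 ≤ z → ∃ a : A, 0 ≤ a ∧ I.proj a = z := fun z hz => by
      obtain ⟨a, rfl⟩ := I.proj_surj z
      refine ⟨0 ⊔ a, le_sup_left, ?_⟩
      rw [I.proj_sup']
      exact sup_eq_right.2 hz
    obtain ⟨a, ha, rfl⟩ := key x hx
    obtain ⟨b, hb, rfl⟩ := key y hy
    exact I.proj_mono (mul_nn ha hb)

instance LIdeal.quotIsLAlgebra [Algebra ℝ A] [IsLAlgebra A] : IsLAlgebra I.Quot where
  smul_nonneg' r x hr hx := by
    obtain ⟨a, rfl⟩ := I.proj_surj x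
    have : I.proj (0 ⊔ a) = I.proj a := by
      rw [I.proj_sup']
      exact sup_eq_right.2 hx
    rw [← this]
    exact I.proj_mono (smul_nn hr (le_sup_left : (0 : A) ≤ 0 ⊔ a))

/-- An `ℓ`-ideal `I` is archimedean if `A ⧸ I` is archimedean. -/
def LIdeal.IsArch : Prop := IsLArchimedean I.Quot

lemma LIdeal.sInf_isArch {T : Set (LIdeal A)} (h : ∀ J ∈ T, J.IsArch) :
    (LIdeal.sInf T).IsArch := by
  intro x y hxy
  obtain ⟨a, rfl⟩ := LIdeal.proj_surj _ x
  obtain ⟨b, rfl⟩ := LIdeal.proj_surj _ y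
  refine (LIdeal.proj_le_mk_iff (sInf T) (b := 0)).2 ⟨a ⊔ 0, ?_, by simp⟩
  rw [LIdeal.mem_sInf]
  intro J hJ
  have hle : J.proj a ≤ J.proj 0 := h J hJ (J.proj a) (J.proj b) fun n => by
    have h1 : (LIdeal.sInf T).proj (n • a) ≤ (LIdeal.sInf T).proj b := by
      rw [LIdeal.proj_nsmul]
      exact hxy n
    obtain ⟨c, hc, hle⟩ := (LIdeal.proj_le_mk_iff _).1 h1
    rw [← LIdeal.proj_nsmul]
    exact (LIdeal.proj_le_mk_iff _).2 ⟨c, LIdeal.mem_sInf.1 hc J hJ, hle⟩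
  have : J.proj (a ⊔ 0) = J.proj 0 := by rw [J.proj_sup', sup_eq_right.2 hle]
  simpa using J.proj_eq.1 this

/-- The archimedean `ℓ`-ideal generated by a set: the least archimedean `ℓ`-ideal containing it. -/
def LIdeal.archSpan (S : Set A) : LIdeal A := LIdeal.sInf {I | I.IsArch ∧ S ⊆ I.toIdeal}

lemma LIdeal.archSpan_isArch (S : Set A) : (LIdeal.archSpan S).IsArch :=
  LIdeal.sInf_isArch fun _ h => h.1

lemma LIdeal.subset_archSpan (S : Set A) : S ⊆ (LIdeal.archSpan S).toIdeal :=
  fun _ ha => LIdeal.mem_sInf.2 fun _ hI => hI.2 ha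

lemma LIdeal.archSpan_le {S : Set A} {J : LIdeal A} (hJ : J.IsArch) (h : S ⊆ J.toIdeal) :
    (LIdeal.archSpan S).toIdeal ≤ J.toIdeal :=
  fun _ ha => LIdeal.mem_sInf.1 ha J ⟨hJ, h⟩

end Ideals

/-- The quotient of a bounded archimedean `ℓ`-algebra by an archimedean `ℓ`-ideal. -/
def LIdeal.quotBAL {A : BAL.{u}} (I : LIdeal A) (h : I.IsArch) : BAL.{u} :=
  { carrier := I.Quot
    isBal :=
      { bounded := fun x => by
          obtain ⟨a, rfl⟩ := I.proj_surj x
          obtain ⟨n, hn⟩ := IsBal.bounded a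
          refine ⟨n, ?_⟩
          have := I.proj_mono hn
          rwa [LIdeal.proj_nsmul] at this
        archimedean := h } }

/-- The quotient map, as a morphism. -/
def LIdeal.mkHom {A : BAL.{u}} (I : LIdeal A) (h : I.IsArch) : A ⟶ I.quotBAL h :=
  ⟨{ Ideal.Quotient.mkₐ ℝ I.toIdeal with
      map_sup' := fun _ _ => rfl
      map_inf' := fun _ _ => rfl }⟩

/-- The kernel of a morphism, as an `ℓ`-ideal. -/
def kerL {A B : BAL.{u}} (f : A ⟶ B) : LIdeal A where
  toIdeal := RingHom.ker f.hom
  solid a b h hb := by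
    rw [RingHom.mem_ker] at hb ⊢
    have h1 := f.hom.map_mono h
    rw [f.hom.map_abs, f.hom.map_abs, hb] at h1
    have h2 : |f.hom a| ≤ 0 := by simpa [abs] using h1
    apply le_antisymm ((le_abs_self _).trans h2)
    simpa using (neg_le_abs (f.hom a)).trans h2

lemma mem_kerL {A B : BAL.{u}} (f : A ⟶ B) {a : A} : a ∈ (kerL f).toIdeal ↔ f.hom a = 0 :=
  RingHom.mem_ker

lemma kerL_isArch {A B : BAL.{u}} (f : A ⟶ B) : (kerL f).IsArch := by
  have key : ∀ a b : A, (kerL f).proj a ≤ (kerL f).proj b ↔ f.hom a ≤ f.hom b := fun a b => by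
    rw [← sup_eq_right, ← LIdeal.proj_sup', LIdeal.proj_eq, mem_kerL, map_sub, map_sup, sub_eq_zero,
      sup_eq_right]
  intro x y hxy
  obtain ⟨a, rfl⟩ := LIdeal.proj_surj _ x
  obtain ⟨b, rfl⟩ := LIdeal.proj_surj _ y
  refine (key a 0).2 ?_
  rw [map_zero]
  refine IsBal.archimedean (f.hom a) (f.hom b) fun n => ?_
  rw [← map_nsmul]
  refine (key _ _).1 ?_
  rw [LIdeal.proj_nsmul]
  exact hxy n

/-- Morphisms out of a quotient. -/
def LIdeal.descHom {A B : BAL.{u}} (I : LIdeal A) (h : I.IsArch) (f : A ⟶ B)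
    (hf : ∀ a ∈ I.toIdeal, f.hom a = 0) : I.quotBAL h ⟶ B :=
  ⟨{ Ideal.Quotient.liftₐ I.toIdeal f.hom.toAlgHom hf with
      map_sup' := fun x y => by
        obtain ⟨a, rfl⟩ := I.proj_surj x
        obtain ⟨b, rfl⟩ := I.proj_surj y
        exact map_sup f.hom a b
      map_inf' := fun x y => by
        obtain ⟨a, rfl⟩ := I.proj_surj x
        obtain ⟨b, rfl⟩ := I.proj_surj y
        exact map_inf f.hom a b }⟩

lemma LIdeal.descHom_mk {A B : BAL.{u}} (I : LIdeal A) (h : I.IsArch) (f : A ⟶ B)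
    (hf : ∀ a ∈ I.toIdeal, f.hom a = 0) : I.mkHom h ≫ I.descHom h f hf = f := rfl

lemma LIdeal.quot_hom_ext {A B : BAL.{u}} {I : LIdeal A} {h : I.IsArch} {f g : I.quotBAL h ⟶ B}
    (hfg : I.mkHom h ≫ f = I.mkHom h ≫ g) : f = g := by
  refine BAL.hom_ext fun x => ?_
  obtain ⟨a, rfl⟩ := I.proj_surj x
  exact congrArg (fun k : A ⟶ B => k.hom a) hfg

end Bal

namespace Bal

/-! ### Free objects over weighted sets

The free object over a weighted set `(X, w)` is built from formal `ℓ`-algebra terms over `X`, two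
terms being identified when they agree under every weighted set morphism from `(X, w)` to a bounded
archimedean `ℓ`-algebra. Its universal property is `Free.existsUnique_lift`. -/

/-- Formal `ℓ`-algebra terms with variables in `X` and real constants. -/
inductive LTerm (X : Type u) : Type u
  | var (x : X) : LTerm X
  | const (r : ℝ) : LTerm X
  | add (s t : LTerm X) : LTerm X
  | mul (s t : LTerm X) : LTerm X
  | sup (s t : LTerm X) : LTerm X
  | inf (s t : LTerm X) : LTerm X

/-- Evaluation of terms. -/
def LTerm.eval {X : Type u} {B : Type*} [CommRing B] [Lattice B] [Algebra ℝ B] (v : X → B) :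
    LTerm X → B
  | var x => v x
  | const r => algebraMap ℝ B r
  | add s t => s.eval v + t.eval v
  | mul s t => s.eval v * t.eval v
  | sup s t => s.eval v ⊔ t.eval v
  | inf s t => s.eval v ⊓ t.eval v

/-- Weighted set morphisms from `(X, w)` to `(B, ‖·‖)`. -/
def IsWeighted {X : Type*} (w : X → NNReal) {B : Type*} [CommRing B] [Lattice B] [Algebra ℝ B]
    (v : X → B) : Prop :=
  ∀ x, lnorm (v x) ≤ w x

/-- Weighted set morphisms from `(X, w)` to arbitrary bounded archimedean `ℓ`-algebras. -/
structure WVal {X : Type u} (w : X → NNReal) : Type (u + 1) where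
  /-- The target algebra. -/
  obj : BAL.{u}
  /-- The map. -/
  val : X → obj
  isWeighted : IsWeighted w val

/-- Terms are identified when they have the same value under all weighted set morphisms. -/
def freeSetoid {X : Type u} (w : X → NNReal) : Setoid (LTerm X) where
  r s t := ∀ i : WVal.{u} w, s.eval i.val = t.eval i.val
  iseqv := ⟨fun _ _ => rfl, fun h i => (h i).symm, fun h h' i => (h i).trans (h' i)⟩

/-- The underlying type of the free object over `(X, w)`. -/
def Free {X : Type u} (w : X → NNReal) : Type u := Quotient (freeSetoid w)

namespace Free

variable {X : Type u} {w : X → NNReal}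

/-- The value of an element of the free object under a weighted set morphism. -/
def ev (i : WVal.{u} w) (x : Free w) : i.obj :=
  Quotient.liftOn x (fun t => t.eval i.val) fun _ _ h => h i

/-- All values at once. -/
def evAll (x : Free w) : ∀ i : WVal.{u} w, i.obj := fun i => ev i x

lemma evAll_injective : Function.Injective (evAll : Free w → ∀ i : WVal.{u} w, i.obj) := by
  intro x y h
  induction x using Quotient.inductionOn
  induction y using Quotient.inductionOn
  exact Quotient.sound fun i => congrFun h i

/-- The class of a term. -/
def ofTerm (w : X → NNReal) (t : LTerm X) : Free w := Quotient.mk (freeSetoid w) t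

lemma ev_ofTerm (i : WVal.{u} w) (t : LTerm X) : ev i (ofTerm w t) = t.eval i.val := rfl

/-- Real constants. -/
def const (w : X → NNReal) (r : ℝ) : Free w := ofTerm w (.const r)

instance : Add (Free w) :=
  ⟨Quotient.map₂ .add fun _ _ h _ _ h' i => congrArg₂ (· + ·) (h i) (h' i)⟩

instance : Mul (Free w) :=
  ⟨Quotient.map₂ .mul fun _ _ h _ _ h' i => congrArg₂ (· * ·) (h i) (h' i)⟩

instance : Max (Free w) :=
  ⟨Quotient.map₂ .sup fun _ _ h _ _ h' i => congrArg₂ (· ⊔ ·) (h i) (h' i)⟩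

instance : Min (Free w) :=
  ⟨Quotient.map₂ .inf fun _ _ h _ _ h' i => congrArg₂ (· ⊓ ·) (h i) (h' i)⟩

instance : Zero (Free w) := ⟨const w 0⟩

instance : One (Free w) := ⟨const w 1⟩

instance : SMul ℝ (Free w) := ⟨fun r x => const w r * x⟩

instance : Neg (Free w) := ⟨fun x => const w (-1) * x⟩

instance : Sub (Free w) := ⟨fun x y => x + -y⟩

instance : NatCast (Free w) := ⟨fun n => const w n⟩

instance : IntCast (Free w) := ⟨fun n => const w n⟩

instance : SMul ℕ (Free w) := ⟨fun n x => const w n * x⟩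

instance : SMul ℤ (Free w) := ⟨fun n x => const w n * x⟩

instance : Pow (Free w) ℕ := ⟨fun x n => Nat.rec 1 (fun _ y => y * x) n⟩

instance : LE (Free w) := ⟨fun x y => ∀ i : WVal.{u} w, ev i x ≤ ev i y⟩

instance : LT (Free w) := ⟨fun x y => x ≤ y ∧ ¬ y ≤ x⟩

lemma ev_const (i : WVal.{u} w) (r : ℝ) : ev i (const w r) = algebraMap ℝ i.obj r := rfl

lemma ev_add (i : WVal.{u} w) (x y : Free w) : ev i (x + y) = ev i x + ev i y := by
  induction x using Quotient.inductionOn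
  induction y using Quotient.inductionOn
  rfl

lemma ev_mul (i : WVal.{u} w) (x y : Free w) : ev i (x * y) = ev i x * ev i y := by
  induction x using Quotient.inductionOn
  induction y using Quotient.inductionOn
  rfl

lemma ev_sup (i : WVal.{u} w) (x y : Free w) : ev i (x ⊔ y) = ev i x ⊔ ev i y := by
  induction x using Quotient.inductionOn
  induction y using Quotient.inductionOn
  rfl

lemma ev_inf (i : WVal.{u} w) (x y : Free w) : ev i (x ⊓ y) = ev i x ⊓ ev i y := by
  induction x using Quotient.inductionOn
  induction y using Quotient.inductionOn
  rfl

lemma ev_zero (i : WVal.{u} w) : ev i (0 : Free w) = 0 := map_zero (algebraMap ℝ i.obj)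

lemma ev_one (i : WVal.{u} w) : ev i (1 : Free w) = 1 := map_one (algebraMap ℝ i.obj)

lemma ev_smul (i : WVal.{u} w) (r : ℝ) (x : Free w) : ev i (r • x) = r • ev i x := by
  rw [Algebra.smul_def, ← ev_const, ← ev_mul]
  rfl

lemma ev_neg (i : WVal.{u} w) (x : Free w) : ev i (-x) = -ev i x := by
  change ev i (const w (-1) * x) = _
  rw [ev_mul, ev_const]
  simp

lemma ev_sub (i : WVal.{u} w) (x y : Free w) : ev i (x - y) = ev i x - ev i y := by
  change ev i (x + -y) = _
  rw [ev_add, ev_neg, sub_eq_add_neg]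

lemma ev_natCast (i : WVal.{u} w) (n : ℕ) : ev i (n : Free w) = n := by
  change ev i (const w n) = _
  rw [ev_const, map_natCast]

lemma ev_intCast (i : WVal.{u} w) (n : ℤ) : ev i (n : Free w) = n := by
  change ev i (const w n) = _
  rw [ev_const, map_intCast]

lemma ev_nsmul (i : WVal.{u} w) (n : ℕ) (x : Free w) : ev i (n • x) = n • ev i x := by
  change ev i (const w n * x) = _
  rw [ev_mul, ev_const, map_natCast, nsmul_eq_mul]

lemma ev_zsmul (i : WVal.{u} w) (n : ℤ) (x : Free w) : ev i (n • x) = n • ev i x := by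
  change ev i (const w n * x) = _
  rw [ev_mul, ev_const, map_intCast, zsmul_eq_mul]

lemma ev_pow (i : WVal.{u} w) (x : Free w) (n : ℕ) : ev i (x ^ n) = ev i x ^ n := by
  induction n with
  | zero => rw [pow_zero]; exact ev_one i
  | succ k ih =>
    rw [pow_succ, ← ih, ← ev_mul]
    rfl

instance commRing : CommRing (Free w) :=
  evAll_injective.commRing evAll (funext ev_zero) (funext ev_one)
    (fun x y => funext fun i => ev_add i x y) (fun x y => funext fun i => ev_mul i x y)
    (fun x => funext fun i => ev_neg i x) (fun x y => funext fun i => ev_sub i x y)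
    (fun n x => funext fun i => ev_nsmul i n x) (fun n x => funext fun i => ev_zsmul i n x)
    (fun x n => funext fun i => ev_pow i x n) (fun n => funext fun i => ev_natCast i n)
    (fun n => funext fun i => ev_intCast i n)

instance lattice : Lattice (Free w) :=
  evAll_injective.lattice evAll Iff.rfl
    (fun {_ _} => by rw [lt_iff_le_not_ge]; exact Iff.rfl)
    (fun x y => funext fun i => ev_sup i x y) (fun x y => funext fun i => ev_inf i x y)

instance algebra : Algebra ℝ (Free w) where
  algebraMap :=
    { toFun := const w
      map_one' := rfl
      map_zero' := rfl
      map_mul' := fun r s => evAll_injective <| funext fun i => by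
        change ev i _ = ev i _
        simp only [ev_mul, ev_const, map_mul]
      map_add' := fun r s => evAll_injective <| funext fun i => by
        change ev i _ = ev i _
        simp only [ev_add, ev_const, map_add] }
  commutes' _ _ := mul_comm _ _
  smul_def' _ _ := rfl

instance : IsLAlgebra (Free w) where
  add_le_add_right' x y z h i := by
    rw [ev_add, ev_add]
    exact add_le_add_left (h i) _
  mul_nonneg' x y hx hy i := by
    rw [ev_zero, ev_mul]
    exact mul_nn ((ev_zero i).symm.le.trans (hx i)) ((ev_zero i).symm.le.trans (hy i))
  smul_nonneg' r x hr hx i := by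
    rw [ev_zero, ev_smul]
    exact smul_nn hr ((ev_zero i).symm.le.trans (hx i))

lemma term_bounded (w : X → NNReal) (t : LTerm X) :
    ∃ n : ℕ, ∀ i : WVal.{u} w, |t.eval i.val| ≤ n • (1 : i.obj) := by
  induction t with
  | var x =>
    obtain ⟨n, hn⟩ := exists_nat_gt (w x : ℝ)
    refine ⟨n, fun i => ?_⟩
    rw [nsmul_one_eq]
    exact abs_le_of_lnorm_lt IsBal.bounded ((i.isWeighted x).trans_lt hn)
  | const r =>
    obtain ⟨n, hn⟩ := exists_nat_gt |r|
    refine ⟨n, fun i => ?_⟩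
    rw [nsmul_one_eq, LTerm.eval, Algebra.algebraMap_eq_smul_one]
    refine abs_le'.2 ⟨smul_one_mono IsBal.bounded ((le_abs_self r).trans hn.le), ?_⟩
    rw [← neg_smul]
    exact smul_one_mono IsBal.bounded ((neg_le_abs r).trans hn.le)
  | add s t hs ht =>
    obtain ⟨m, hm⟩ := hs
    obtain ⟨n, hn⟩ := ht
    refine ⟨m + n, fun i => ?_⟩
    rw [add_nsmul]
    exact (abs_add_le _ _).trans (add_le_add (hm i) (hn i))
  | mul s t hs ht =>
    obtain ⟨m, hm⟩ := hs
    obtain ⟨n, hn⟩ := ht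
    refine ⟨m * n, fun i => (abs_mul_le _ _).trans ?_⟩
    have h1 := mul_nn (abs_nonneg (s.eval i.val)) (sub_nonneg.2 (hn i))
    have h2 := mul_nn (sub_nonneg.2 (hm i)) ((abs_nonneg _).trans (hn i))
    refine sub_nonneg.1 ((add_nonneg h1 h2).trans_eq ?_)
    simp only [nsmul_eq_mul, mul_one, Nat.cast_mul]
    ring
  | sup s t hs ht =>
    obtain ⟨m, hm⟩ := hs
    obtain ⟨n, hn⟩ := ht
    refine ⟨m + n, fun i => ?_⟩
    have hm' := (abs_nonneg _).trans (hm i)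
    have hn' := (abs_nonneg _).trans (hn i)
    rw [add_nsmul]
    refine abs_le'.2 ⟨sup_le ?_ ?_, ?_⟩
    · exact ((le_abs_self _).trans (hm i)).trans (le_add_of_nonneg_right hn')
    · exact ((le_abs_self _).trans (hn i)).trans (le_add_of_nonneg_left hm')
    · refine (neg_le_neg (le_sup_left : s.eval i.val ≤ _)).trans ?_
      exact ((neg_le_abs _).trans (hm i)).trans (le_add_of_nonneg_right hn')
  | inf s t hs ht =>
    obtain ⟨m, hm⟩ := hs
    obtain ⟨n, hn⟩ := ht
    refine ⟨m + n, fun i => ?_⟩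
    have hm' := (abs_nonneg _).trans (hm i)
    have hn' := (abs_nonneg _).trans (hn i)
    rw [add_nsmul]
    refine abs_le'.2 ⟨?_, ?_⟩
    · refine (inf_le_left : _ ≤ s.eval i.val).trans ?_
      exact ((le_abs_self _).trans (hm i)).trans (le_add_of_nonneg_right hn')
    · rw [LTerm.eval, neg_inf]
      refine sup_le ?_ ?_
      · exact ((neg_le_abs _).trans (hm i)).trans (le_add_of_nonneg_right hn')
      · exact ((neg_le_abs _).trans (hn i)).trans (le_add_of_nonneg_left hm')

instance : IsBal (Free w) where
  bounded x := by
    induction x using Quotient.inductionOn with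
    | h t =>
      obtain ⟨n, hn⟩ := term_bounded w t
      refine ⟨n, fun i => ?_⟩
      rw [ev_nsmul, ev_one]
      exact (le_abs_self _).trans (hn i)
  archimedean x y h i := by
    rw [ev_zero]
    refine IsBal.archimedean _ (ev i y) fun n => ?_
    rw [← ev_nsmul]
    exact h n i

/-- The free object in `BAL` over the weighted set `(X, w)`. -/
def bal (w : X → NNReal) : BAL.{u} := { carrier := Free w }

/-- The universal map `X → F(X, w)`. -/
def of (w : X → NNReal) (x : X) : bal w := ofTerm w (.var x)

lemma lnorm_var_le (w : X → NNReal) (x : X) : lnorm (ofTerm w (.var x)) ≤ w x := by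
  refine le_of_forall_gt_imp_ge_of_dense fun r hr => ?_
  refine lnorm_le_of IsBal.bounded ((w x).2.trans hr.le) ?_
  have key : ∀ i : WVal.{u} w, |i.val x| ≤ r • (1 : i.obj) := fun i =>
    abs_le_of_lnorm_lt IsBal.bounded ((i.isWeighted x).trans_lt hr)
  refine abs_le'.2 ⟨fun i => ?_, fun i => ?_⟩
  · rw [ev_smul, ev_one]
    exact (le_abs_self _).trans (key i)
  · rw [ev_smul, ev_one, ev_neg]
    exact (neg_le_abs _).trans (key i)

lemma isWeighted_of (w : X → NNReal) : IsWeighted w (of w) := lnorm_var_le w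

/-- The morphism out of the free object induced by a weighted set morphism. -/
def lift {B : BAL.{u}} (v : X → B) (hv : IsWeighted w v) : bal w ⟶ B :=
  ⟨{ toFun := ev ⟨B, v, hv⟩
     map_one' := ev_one _
     map_mul' := ev_mul _
     map_zero' := ev_zero _
     map_add' := ev_add _
     commutes' := ev_const (w := w) ⟨B, v, hv⟩
     map_sup' := ev_sup _
     map_inf' := ev_inf _ }⟩

lemma lift_of {B : BAL.{u}} (v : X → B) (hv : IsWeighted w v) (x : X) :
    (lift v hv).hom (of w x) = v x := rfl

lemma hom_ext {B : BAL.{u}} {f g : bal w ⟶ B} (h : ∀ x, f.hom (of w x) = g.hom (of w x)) :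
    f = g := by
  refine BAL.hom_ext fun x => ?_
  induction x using Quotient.inductionOn with
  | h t =>
    induction t with
    | var x => exact h x
    | const r =>
      exact (AlgHomClass.commutes f.hom r).trans (AlgHomClass.commutes g.hom r).symm
    | add s t hs ht =>
      exact (map_add f.hom _ _).trans ((congrArg₂ (· + ·) hs ht).trans (map_add g.hom _ _).symm)
    | mul s t hs ht =>
      exact (map_mul f.hom _ _).trans ((congrArg₂ (· * ·) hs ht).trans (map_mul g.hom _ _).symm)
    | sup s t hs ht =>
      exact (map_sup f.hom _ _).trans ((congrArg₂ (· ⊔ ·) hs ht).trans (map_sup g.hom _ _).symm)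
    | inf s t hs ht =>
      exact (map_inf f.hom _ _).trans ((congrArg₂ (· ⊓ ·) hs ht).trans (map_inf g.hom _ _).symm)

/-- The universal property of the free object over a weighted set. -/
lemma existsUnique_lift {B : BAL.{u}} (v : X → B) (hv : IsWeighted w v) :
    ∃! f : bal w ⟶ B, ∀ x, f.hom (of w x) = v x :=
  ⟨lift v hv, lift_of v hv, fun _ hf => hom_ext fun x => (hf x).trans (lift_of v hv x).symm⟩

end Free

/-! ### The endofunctor `H` -/

/-- The weight function `w_A(a) = max {‖a‖, 1}`. -/
noncomputable def weight (A : BAL.{u}) (a : A) : NNReal :=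
  ⟨max (lnorm a) 1, zero_le_one.trans (le_max_right _ _)⟩

/-- `F(A)`, the free object over `(A, w_A)`. -/
noncomputable def FObj (A : BAL.{u}) : BAL.{u} := Free.bal (weight A)

/-- The map `f_A : A → F(A)`. -/
noncomputable def fMap (A : BAL.{u}) (a : A) : FObj A := Free.of (weight A) a

/-- The generators of the ideal `I_A`. -/
inductive HRel (A : BAL.{u}) : FObj A → Prop
  | inf (a b : A) : HRel A (fMap A (a ⊓ b) - fMap A a ⊓ fMap A b)
  | const (r : ℝ) :
    HRel A (fMap A (algebraMap ℝ A r) - algebraMap ℝ (FObj A) r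
      - (1 - algebraMap ℝ (FObj A) r) * fMap A 0)
  | pos (a : A) : HRel A (fMap A (a ⊔ 0) - fMap A a ⊔ 0)
  | add (a : A) (r : ℝ) :
    HRel A (fMap A (a + algebraMap ℝ A r) - fMap A a - fMap A (algebraMap ℝ A r) + fMap A 0)
  | smul (r : ℝ) (a : A) (hr : 0 ≤ r) :
    HRel A (fMap A (r • a) - fMap A (algebraMap ℝ A r) * fMap A a)

/-- The archimedean `ℓ`-ideal `I_A` of `F(A)`. -/
noncomputable def idealI (A : BAL.{u}) : LIdeal (FObj A) :=
  LIdeal.archSpan {x | HRel A x}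

lemma idealI_isArch (A : BAL.{u}) : (idealI A).IsArch := LIdeal.archSpan_isArch _

/-- `H(A) = F(A) / I_A`. -/
noncomputable def HObj (A : BAL.{u}) : BAL.{u} := (idealI A).quotBAL (idealI_isArch A)

/-- The quotient map `F(A) → H(A)`. -/
noncomputable def quotH (A : BAL.{u}) : FObj A ⟶ HObj A := (idealI A).mkHom (idealI_isArch A)

/-- The map `h_A : A → H(A)`, `a ↦ □_a`. -/
noncomputable def hMap (A : BAL.{u}) (a : A) : HObj A := (quotH A).hom (fMap A a)

lemma quotH_eq_zero {A : BAL.{u}} {x : FObj A} (hx : x ∈ (idealI A).toIdeal) :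
    (quotH A).hom x = 0 :=
  Ideal.Quotient.eq_zero_iff_mem.2 hx

lemma weighted_comp {A B : BAL.{u}} (α : A ⟶ B) :
    IsWeighted (weight A) fun a => hMap B (α.hom a) := by
  intro a
  refine ((quotH B).hom.lnorm_map_le IsBal.bounded IsBal.bounded _).trans ?_
  refine (Free.isWeighted_of (weight B) (α.hom a)).trans ?_
  exact max_le_max (α.hom.lnorm_map_le IsBal.bounded IsBal.bounded a) le_rfl

/-- The morphism `F(A) → H(B)` induced by `α : A ⟶ B`. -/
noncomputable def preHMap {A B : BAL.{u}} (α : A ⟶ B) : FObj A ⟶ HObj B :=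
  Free.lift (fun a => hMap B (α.hom a)) (weighted_comp α)

lemma preHMap_f {A B : BAL.{u}} (α : A ⟶ B) (a : A) :
    (preHMap α).hom (fMap A a) = (quotH B).hom (fMap B (α.hom a)) := rfl

lemma hom_algebraMap {A B : BAL.{u}} (f : A ⟶ B) (r : ℝ) :
    f.hom (algebraMap ℝ A r) = algebraMap ℝ B r := AlgHomClass.commutes f.hom r

lemma preHMap_ideal {A B : BAL.{u}} (α : A ⟶ B) :
    ∀ x ∈ (idealI A).toIdeal, (preHMap α).hom x = 0 := by
  suffices h : {x | HRel A x} ⊆ (kerL (preHMap α)).toIdeal from fun x hx =>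
    (mem_kerL _).1 (LIdeal.archSpan_le (kerL_isArch _) h hx)
  have key : ∀ y, HRel B y → (quotH B).hom y = 0 := fun y hy =>
    quotH_eq_zero (LIdeal.subset_archSpan _ hy)
  intro x hx
  refine (mem_kerL _).2 ?_
  cases hx with
  | inf a b =>
    rw [← key _ (.inf (α.hom a) (α.hom b))]
    simp only [map_sub, map_inf, preHMap_f]
  | const r =>
    rw [← key _ (.const r)]
    simp only [map_sub, map_mul, map_one, map_zero, preHMap_f, hom_algebraMap]
  | pos a =>
    rw [← key _ (.pos (α.hom a))]
    simp only [map_sub, map_sup, map_zero, preHMap_f]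
  | add a r =>
    rw [← key _ (.add (α.hom a) r)]
    simp only [map_sub, map_add, map_zero, preHMap_f, hom_algebraMap]
  | smul r a hr =>
    rw [← key _ (.smul r (α.hom a) hr)]
    simp only [map_sub, map_mul, map_smul, preHMap_f, hom_algebraMap]

/-- `H` on morphisms. -/
noncomputable def HMap {A B : BAL.{u}} (α : A ⟶ B) : HObj A ⟶ HObj B :=
  (idealI A).descHom (idealI_isArch A) (preHMap α) (preHMap_ideal α)

/-- `H(α)(□_a) = □_{α(a)}`. -/
lemma HMap_hMap {A B : BAL.{u}} (α : A ⟶ B) (a : A) :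
    (HMap α).hom (hMap A a) = hMap B (α.hom a) := rfl

lemma HObj_hom_ext {A B : BAL.{u}} {f g : HObj A ⟶ B}
    (h : ∀ a, f.hom (hMap A a) = g.hom (hMap A a)) : f = g :=
  LIdeal.quot_hom_ext (Free.hom_ext h)

/-- The endofunctor `H` of `BAL`. -/
noncomputable def H : BAL.{u} ⥤ BAL.{u} where
  obj := HObj
  map := HMap
  map_id A := HObj_hom_ext fun a => HMap_hMap (𝟙 A) a
  map_comp {A B C} α β := HObj_hom_ext fun a => by
    rw [BAL.comp_hom_apply, HMap_hMap, HMap_hMap, HMap_hMap, BAL.comp_hom_apply]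

end Bal

namespace Bal

/-! ### The Yosida space -/

/-- Maximal `ℓ`-ideals: maximal among the proper `ℓ`-ideals. -/
def LIdeal.IsMax {A : Type*} [CommRing A] [Lattice A] (M : LIdeal A) : Prop :=
  M.toIdeal ≠ ⊤ ∧ ∀ J : LIdeal A, J.toIdeal ≠ ⊤ → M.toIdeal ≤ J.toIdeal → J = M

/-- The set `Y_A` of maximal `ℓ`-ideals of `A`. -/
def Yosida (A : Type*) [CommRing A] [Lattice A] : Type _ := {M : LIdeal A // M.IsMax}

namespace Yosida

section

variable {A : Type*} [CommRing A] [Lattice A]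

lemma one_notMem (M : Yosida A) : (1 : A) ∉ M.1.toIdeal :=
  fun h => M.2.1 ((Ideal.eq_top_iff_one _).2 h)

/-- The set `Z_ℓ(I)` of all maximal `ℓ`-ideals containing `I`. -/
def Z (I : LIdeal A) : Set (Yosida A) := {M | I.toIdeal ≤ M.1.toIdeal}

lemma eq_of_le {M N : Yosida A} (h : M.1.toIdeal ≤ N.1.toIdeal) : M = N :=
  Subtype.ext (M.2.2 N.1 N.2.1 h).symm

end

section

variable {A : Type*} [CommRing A] [Lattice A] [Algebra ℝ A] [IsBal A]

lemma smul_one_mem {M : Yosida A} {r : ℝ} (h : r • (1 : A) ∈ M.1.toIdeal) : r = 0 := by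
  by_contra hr
  apply M.one_notMem
  have := M.1.toIdeal.smul_of_tower_mem r⁻¹ h
  rwa [smul_smul, inv_mul_cancel₀ hr, one_smul] at this

lemma abs_of_nn {a : A} (h : 0 ≤ a) : |a| = a := abs_of_nonneg h

lemma smul_abs_nn {r : ℝ} (hr : 0 ≤ r) (a : A) : 0 ≤ r • |a| := smul_nn hr (abs_nonneg a)

/-- The `ℓ`-ideal generated by a maximal `ℓ`-ideal and an element. -/
def adjoin (M : Yosida A) (x : A) : LIdeal A where
  toIdeal :=
    { carrier := {z | ∃ m ∈ M.1.toIdeal, ∃ r : ℝ, 0 ≤ r ∧ 0 ≤ m ∧ |z| ≤ m + r • |x|}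
      zero_mem' := ⟨0, zero_mem _, 0, le_rfl, le_rfl, by simp [abs]⟩
      add_mem' := by
        rintro a b ⟨m, hm, r, hr, hm0, h⟩ ⟨m', hm', r', hr', hm0', h'⟩
        refine ⟨m + m', add_mem hm hm', r + r', add_nonneg hr hr', add_nonneg hm0 hm0', ?_⟩
        refine ((abs_add_le a b).trans (add_le_add h h')).trans_eq ?_
        rw [add_smul]
        abel
      smul_mem' := by
        rintro c a ⟨m, hm, r, hr, hm0, h⟩
        obtain ⟨k, hk⟩ := IsBal.bounded |c|
        have hk0 : (0 : ℝ) ≤ k := k.cast_nonneg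
        refine ⟨(k : ℝ) • m, M.1.toIdeal.smul_of_tower_mem _ hm, k * r, mul_nonneg hk0 hr,
          smul_nn hk0 hm0, ?_⟩
        refine (abs_mul_le c a).trans ?_
        have h1 : |c| * |a| ≤ (k : ℝ) • |a| := by
          rw [nsmul_one_eq] at hk
          have := mul_nn (sub_nonneg.2 hk) (abs_nonneg a)
          refine sub_nonneg.1 (this.trans_eq ?_)
          rw [sub_mul, smul_mul_assoc, one_mul]
        refine h1.trans ((smul_mono hk0 h).trans_eq ?_)
        rw [smul_add, smul_smul] }
  solid := by
    rintro a b h ⟨m, hm, r, hr, hm0, h'⟩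
    exact ⟨m, hm, r, hr, hm0, h.trans h'⟩

lemma exists_of_notMem {M : Yosida A} {x : A} (hx : x ∉ M.1.toIdeal) :
    ∃ m ∈ M.1.toIdeal, ∃ r : ℝ, 0 ≤ r ∧ 0 ≤ m ∧ 1 ≤ m + r • |x| := by
  have h1 : (1 : A) ∈ (adjoin M x).toIdeal := by
    rw [← Ideal.eq_top_iff_one]
    by_contra hne
    have hle : M.1.toIdeal ≤ (adjoin M x).toIdeal := fun m hm =>
      ⟨|m|, M.1.abs_mem hm, 0, le_rfl, abs_nonneg m, by simp⟩
    have hEq := M.2.2 _ hne hle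
    apply hx
    rw [← hEq]
    exact ⟨0, zero_mem _, 1, zero_le_one, le_rfl, by simp⟩
  obtain ⟨m, hm, r, hr, hm0, h⟩ := h1
  exact ⟨m, hm, r, hr, hm0, (le_abs_self 1).trans h⟩

lemma mem_of_nn_le {M : Yosida A} {a b : A} (ha : 0 ≤ a) (h : a ≤ b) (hb : b ∈ M.1.toIdeal) :
    a ∈ M.1.toIdeal :=
  M.1.of_le ((abs_of_nn ha).le.trans h) hb

lemma mem_or_mem {M : Yosida A} {x y : A} (hx : 0 ≤ x) (hy : 0 ≤ y)
    (h : x ⊓ y ∈ M.1.toIdeal) : x ∈ M.1.toIdeal ∨ y ∈ M.1.toIdeal := by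
  by_contra hcon
  push Not at hcon
  obtain ⟨m, hm, r, hr, hm0, h1⟩ := exists_of_notMem hcon.1
  obtain ⟨n, hn, s, hs, hn0, h2⟩ := exists_of_notMem hcon.2
  rw [abs_of_nn hx] at h1
  rw [abs_of_nn hy] at h2
  have ht : 0 < r + s + 1 := by positivity
  set t := r + s + 1 with ht_def
  have e1 : 1 - (m + n) ≤ t • x := by
    have : r • x ≤ t • x := by
      apply sub_nonneg.1
      rw [← sub_smul]
      exact smul_nn (by rw [ht_def]; linarith) hx
    rw [sub_le_iff_le_add]
    refine h1.trans ?_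
    rw [add_comm m]
    exact add_le_add this (le_add_of_nonneg_right hn0)
  have e2 : 1 - (m + n) ≤ t • y := by
    have : s • y ≤ t • y := by
      apply sub_nonneg.1
      rw [← sub_smul]
      exact smul_nn (by rw [ht_def]; linarith) hy
    rw [sub_le_iff_le_add]
    refine h2.trans ?_
    rw [add_comm n]
    exact add_le_add this (le_add_of_nonneg_left hm0)
  have e3 : t⁻¹ • (1 - (m + n)) ≤ x ⊓ y := by
    refine le_inf ?_ ?_
    · have := smul_mono (inv_nonneg.2 ht.le) e1
      rwa [smul_smul, inv_mul_cancel₀ ht.ne', one_smul] at this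
    · have := smul_mono (inv_nonneg.2 ht.le) e2
      rwa [smul_smul, inv_mul_cancel₀ ht.ne', one_smul] at this
  have e4 := smul_mono ht.le e3
  rw [smul_smul, mul_inv_cancel₀ ht.ne', one_smul, sub_le_iff_le_add] at e4
  exact M.one_notMem (mem_of_nn_le (one_nn IsBal.bounded) e4
    (add_mem (M.1.toIdeal.smul_of_tower_mem t h) (add_mem hm hn)))

lemma pos_or_neg_mem (M : Yosida A) (a : A) :
    a ⊔ 0 ∈ M.1.toIdeal ∨ (-a) ⊔ 0 ∈ M.1.toIdeal := by
  apply mem_or_mem le_sup_right le_sup_right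
  have : (a ⊔ 0) ⊓ (-a ⊔ 0) = 0 := posPart_inf_negPart_eq_zero a
  rw [this]
  exact zero_mem _

lemma mem_of_forall_pos {M : Yosida A} {x : A}
    (h : ∀ ε : ℝ, 0 < ε → ∃ m ∈ M.1.toIdeal, |x| ≤ m + ε • (1 : A)) : x ∈ M.1.toIdeal := by
  by_contra hx
  obtain ⟨m, hm, r, hr, hm0, h1⟩ := exists_of_notMem hx
  obtain ⟨n, hn, h2⟩ := h (1 / (2 * (r + 1))) (by positivity)
  have h3 := h1.trans (add_le_add le_rfl (smul_mono hr h2))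
  rw [smul_add, smul_smul] at h3
  have h4 : (r * (1 / (2 * (r + 1)))) • (1 : A) ≤ (1 / 2 : ℝ) • (1 : A) := by
    apply smul_one_mono IsBal.bounded
    rw [mul_one_div, div_le_div_iff₀ (by positivity) (by positivity)]
    linarith
  have h5 : (1 : A) ≤ m + (r • n + (1 / 2 : ℝ) • (1 : A)) :=
    h3.trans (add_le_add le_rfl (add_le_add le_rfl h4))
  have h6 : (1 / 2 : ℝ) • (1 : A) ≤ m + r • n := by
    have e : (1 : A) = (1 / 2 : ℝ) • (1 : A) + (1 / 2 : ℝ) • (1 : A) := by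
      rw [← add_smul]
      norm_num
    rw [← add_assoc] at h5
    nth_rewrite 1 [e] at h5
    exact le_of_add_le_add_right h5
  have h7 := mem_of_nn_le (smul_nn (by norm_num) (one_nn IsBal.bounded)) h6
    (add_mem hm (M.1.toIdeal.smul_of_tower_mem r hn))
  have := smul_one_mem h7
  norm_num at this

lemma exists_real (M : Yosida A) (a : A) : ∃ r : ℝ, a - r • (1 : A) ∈ M.1.toIdeal := by
  set S : Set ℝ := {s | (s • (1 : A) - a) ⊔ 0 ∈ M.1.toIdeal} with hS
  have hne : S.Nonempty := by
    obtain ⟨n, hn⟩ := IsBal.bounded (-a)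
    refine ⟨-(n : ℝ), ?_⟩
    have : (-(n : ℝ)) • (1 : A) - a ≤ 0 := by
      rw [nsmul_one_eq] at hn
      rw [neg_smul, sub_eq_add_neg, neg_add_eq_sub]
      exact sub_nonpos.2 hn
    change ((-(n : ℝ)) • (1 : A) - a) ⊔ 0 ∈ M.1.toIdeal
    rw [sup_eq_right.2 this]
    exact zero_mem _
  have hbd : BddAbove S := by
    obtain ⟨n, hn⟩ := IsBal.bounded a
    refine ⟨n, fun s hs => ?_⟩
    by_contra hlt
    push Not at hlt
    have h1 : (s - n) • (1 : A) ≤ (s • (1 : A) - a) ⊔ 0 := by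
      refine le_trans ?_ le_sup_left
      rw [sub_smul]
      rw [nsmul_one_eq] at hn
      exact sub_le_sub le_rfl hn
    have h2 := mem_of_nn_le (smul_nn (sub_nonneg.2 hlt.le) (one_nn IsBal.bounded)) h1 hs
    exact (sub_pos.2 hlt).ne' (smul_one_mem h2)
  refine ⟨sSup S, mem_of_forall_pos fun ε hε => ?_⟩
  obtain ⟨s, hs, hlt⟩ := exists_lt_of_lt_csSup hne (sub_lt_self (sSup S) hε)
  have hs' : (a - (sSup S + ε) • (1 : A)) ⊔ 0 ∈ M.1.toIdeal := by
    rcases pos_or_neg_mem M (a - (sSup S + ε) • (1 : A)) with h | h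
    · exact h
    · exfalso
      rw [neg_sub] at h
      have := le_csSup hbd h
      linarith
  refine ⟨_, add_mem hs hs', abs_le'.2 ⟨?_, ?_⟩⟩
  · have h1 : a - sSup S • (1 : A) = (a - (sSup S + ε) • (1 : A)) + ε • (1 : A) := by
      rw [add_smul]
      abel
    rw [h1]
    exact add_le_add (le_sup_left.trans (le_add_of_nonneg_left le_sup_right)) le_rfl
  · have h1 : -(a - sSup S • (1 : A)) = (s • (1 : A) - a) + (sSup S - s) • (1 : A) := by
      rw [sub_smul]
      abel
    rw [h1]
    refine add_le_add (le_sup_left.trans (le_add_of_nonneg_right le_sup_right)) ?_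
    exact smul_one_mono IsBal.bounded (by linarith)

/-- The unique real number `r` with `a + M = r + M`. -/
noncomputable def val (M : Yosida A) (a : A) : ℝ := (exists_real M a).choose

lemma val_mem (M : Yosida A) (a : A) : a - M.val a • (1 : A) ∈ M.1.toIdeal :=
  (exists_real M a).choose_spec

lemma val_eq_iff {M : Yosida A} {a : A} {r : ℝ} :
    M.val a = r ↔ a - r • (1 : A) ∈ M.1.toIdeal := by
  constructor
  · rintro rfl
    exact M.val_mem a
  · intro h
    have := sub_mem h (M.val_mem a)
    rw [sub_sub_sub_cancel_left, ← sub_smul] at this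
    exact sub_eq_zero.1 (smul_one_mem this)

lemma val_eq_zero_iff {M : Yosida A} {a : A} : M.val a = 0 ↔ a ∈ M.1.toIdeal := by
  rw [val_eq_iff, zero_smul, sub_zero]

/-- Evaluation at a maximal `ℓ`-ideal, as a morphism to `ℝ`. -/
noncomputable def evHom (M : Yosida A) : BalHom A ℝ where
  toFun := M.val
  map_one' := val_eq_iff.2 (by simp)
  map_zero' := val_eq_iff.2 (by simp)
  map_add' a b := val_eq_iff.2 (by
    have := add_mem (M.val_mem a) (M.val_mem b)
    convert this using 1
    rw [add_smul]
    abel)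
  map_mul' a b := val_eq_iff.2 (by
    have := add_mem (M.1.toIdeal.mul_mem_left b (M.val_mem a))
      (M.1.toIdeal.smul_of_tower_mem (M.val a) (M.val_mem b))
    convert this using 1
    rw [smul_sub, smul_smul, mul_sub, mul_smul_comm, mul_one]
    rw [mul_comm b a]
    abel)
  commutes' r := val_eq_iff.2 (by
    rw [Algebra.algebraMap_eq_smul_one, Algebra.algebraMap_eq_smul_one, smul_eq_mul, mul_one,
      sub_self]
    exact zero_mem _)
  map_sup' a b := val_eq_iff.2 (by
    have h := M.1.sup_mem (M.val_mem a) (M.val_mem b)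
    rcases le_total (M.val a) (M.val b) with hab | hab
    · rwa [sup_eq_right.2 (smul_one_mono IsBal.bounded hab), ← sup_eq_right.2 hab] at h
    · rwa [sup_eq_left.2 (smul_one_mono IsBal.bounded hab), ← sup_eq_left.2 hab] at h)
  map_inf' a b := val_eq_iff.2 (by
    have h := M.1.inf_mem (M.val_mem a) (M.val_mem b)
    rcases le_total (M.val a) (M.val b) with hab | hab
    · rwa [inf_eq_left.2 (smul_one_mono IsBal.bounded hab), ← inf_eq_left.2 hab] at h
    · rwa [inf_eq_right.2 (smul_one_mono IsBal.bounded hab), ← inf_eq_right.2 hab] at h)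

lemma evHom_apply (M : Yosida A) (a : A) : M.evHom a = M.val a := rfl

/-- The kernel of a morphism to `ℝ`, as a point of the Yosida space. -/
def ofHom (φ : BalHom A ℝ) : Yosida A where
  val :=
    { toIdeal := RingHom.ker φ
      solid := fun a b h hb => by
        rw [RingHom.mem_ker] at hb ⊢
        have := φ.map_mono h
        rw [φ.map_abs, φ.map_abs, hb, abs_zero] at this
        exact abs_eq_zero.1 (le_antisymm this (abs_nonneg _)) }
  property := by
    refine ⟨fun h => ?_, fun J hJ hle => LIdeal.ext' (le_antisymm (fun b hb => ?_) hle)⟩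
    · have := (Ideal.eq_top_iff_one _).1 h
      rw [RingHom.mem_ker, map_one] at this
      exact one_ne_zero this
    · rw [RingHom.mem_ker]
      by_contra hne
      apply hJ
      have h1 : b - φ b • (1 : A) ∈ J.toIdeal := hle (by
        change b - φ b • (1 : A) ∈ RingHom.ker φ
        rw [RingHom.mem_ker, map_sub, φ.map_smul_one, smul_eq_mul, mul_one, sub_self])
      have h2 := J.toIdeal.smul_of_tower_mem (φ b)⁻¹ (sub_mem hb h1)
      rw [sub_sub_cancel, smul_smul, inv_mul_cancel₀ hne, one_smul] at h2
      exact (Ideal.eq_top_iff_one _).2 h2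

lemma mem_ofHom {φ : BalHom A ℝ} {a : A} : a ∈ (ofHom φ).1.toIdeal ↔ φ a = 0 := RingHom.mem_ker

lemma inf_mem_of (M : Yosida A) {a b : A} (h : |a| ⊓ |b| ∈ M.1.toIdeal) :
    a ∈ M.1.toIdeal ∨ b ∈ M.1.toIdeal := by
  rcases mem_or_mem (abs_nonneg a) (abs_nonneg b) h with h | h
  · exact Or.inl (M.1.of_le le_rfl h)
  · exact Or.inr (M.1.of_le le_rfl h)

/-- The topology of `Y_A`: the closed sets are exactly the sets `Z_ℓ(I)`. -/
instance : TopologicalSpace (Yosida A) :=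
  TopologicalSpace.ofClosed (Set.range (Z : LIdeal A → Set (Yosida A)))
    ⟨⟨⊤, fun _ _ _ _ => trivial⟩, Set.eq_empty_iff_forall_notMem.2 fun M hM =>
      M.one_notMem (hM trivial)⟩
    (fun T hT => by
      refine ⟨LIdeal.sInf {J | ∀ I : LIdeal A, Z I ∈ T → I.toIdeal ≤ J.toIdeal}, ?_⟩
      ext M
      constructor
      · intro hM S hS
        obtain ⟨I, rfl⟩ := hT hS
        exact fun a ha => hM (LIdeal.mem_sInf.2 fun J hJ => hJ I hS ha)
      · intro hM a ha
        exact LIdeal.mem_sInf.1 ha M.1 fun I hI => hM _ hI)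
    (by
      rintro _ ⟨I, rfl⟩ _ ⟨J, rfl⟩
      refine ⟨⟨I.toIdeal ⊓ J.toIdeal, fun a b h hb => ⟨I.solid a b h hb.1, J.solid a b h hb.2⟩⟩, ?_⟩
      ext M
      constructor
      · intro hM
        by_contra hcon
        have h1 : ¬ I.toIdeal ≤ M.1.toIdeal := fun h => hcon (Or.inl h)
        have h2 : ¬ J.toIdeal ≤ M.1.toIdeal := fun h => hcon (Or.inr h)
        obtain ⟨a, ha, haM⟩ := Set.not_subset.1 h1
        obtain ⟨b, hb, hbM⟩ := Set.not_subset.1 h2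
        have hn : (0 : A) ≤ |a| ⊓ |b| := le_inf (abs_nonneg a) (abs_nonneg b)
        have hab : |a| ⊓ |b| ∈ I.toIdeal ⊓ J.toIdeal :=
          ⟨I.of_le ((abs_of_nn hn).le.trans inf_le_left) (I.abs_mem ha),
            J.of_le ((abs_of_nn hn).le.trans inf_le_right) (J.abs_mem hb)⟩
        rcases M.inf_mem_of (hM hab) with h | h
        · exact haM h
        · exact hbM h
      · rintro (h | h)
        · exact fun a ha => h ha.1
        · exact fun a ha => h ha.2)

lemma isClosed_iff {S : Set (Yosida A)} : IsClosed S ↔ ∃ I, Z I = S := by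
  rw [← isOpen_compl_iff]
  change Sᶜᶜ ∈ Set.range Z ↔ _
  rw [compl_compl]
  rfl

lemma isOpen_notMem (a : A) : IsOpen {M : Yosida A | a ∉ M.1.toIdeal} := by
  rw [← isClosed_compl_iff]
  refine isClosed_iff.2 ⟨LIdeal.span {a}, ?_⟩
  ext M
  simp only [Set.mem_compl_iff, Set.mem_ofPred_eq, not_not]
  constructor
  · intro hM
    exact hM (LIdeal.mem_sInf.2 fun J hJ => hJ rfl)
  · intro ha b hb
    exact LIdeal.mem_sInf.1 hb M.1 (Set.singleton_subset_iff.2 ha)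

lemma lt_val_iff {M : Yosida A} {a : A} {s : ℝ} :
    s < M.val a ↔ (a - s • (1 : A)) ⊔ 0 ∉ M.1.toIdeal := by
  rw [← val_eq_zero_iff, ← evHom_apply, ← evHom_apply, map_sup, map_sub, map_zero,
    BalHom.map_smul_one, smul_eq_mul, mul_one, sup_eq_right, sub_nonpos, not_le]

lemma val_lt_iff {M : Yosida A} {a : A} {s : ℝ} :
    M.val a < s ↔ (s • (1 : A) - a) ⊔ 0 ∉ M.1.toIdeal := by
  rw [← val_eq_zero_iff, ← evHom_apply, ← evHom_apply, map_sup, map_sub, map_zero,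
    BalHom.map_smul_one, smul_eq_mul, mul_one, sup_eq_right, sub_nonpos, not_le]

lemma continuous_val (a : A) : Continuous fun M : Yosida A => M.val a := by
  rw [OrderTopology.topology_eq_generate_intervals (α := ℝ), continuous_generateFrom_iff]
  rintro _ ⟨s, rfl | rfl⟩
  · have : (fun M : Yosida A => M.val a) ⁻¹' Set.Ioi s =
        {M | (a - s • (1 : A)) ⊔ 0 ∉ M.1.toIdeal} := Set.ext fun M => lt_val_iff
    rw [this]
    exact isOpen_notMem _
  · have : (fun M : Yosida A => M.val a) ⁻¹' Set.Iio s =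
        {M | (s • (1 : A) - a) ⊔ 0 ∉ M.1.toIdeal} := Set.ext fun M => val_lt_iff
    rw [this]
    exact isOpen_notMem _

instance : T2Space (Yosida A) where
  t2 M N hne := by
    obtain ⟨a, ha, haN⟩ := Set.not_subset.1 fun h => hne (eq_of_le h)
    refine separated_by_continuous (continuous_val a) ?_
    rw [val_eq_zero_iff.2 ha]
    exact fun h => haN (val_eq_zero_iff.1 h.symm)

instance : CompactSpace (Yosida A) where
  isCompact_univ := by
    rw [isCompact_iff_ultrafilter_le_nhds]
    intro U _
    have key : ∀ a : A, ∃ r : ℝ, Filter.Tendsto (fun M : Yosida A => M.val a) U (nhds r) := by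
      intro a
      obtain ⟨n, hn⟩ := IsBal.bounded |a|
      rw [nsmul_one_eq] at hn
      obtain ⟨r, -, hr⟩ := (isCompact_Icc (a := -(n : ℝ)) (b := n)).ultrafilter_le_nhds
        (U.map fun M : Yosida A => M.val a) (by
          rw [Filter.le_principal_iff]
          refine Filter.mem_map.2 (Filter.univ_mem' fun M => ?_)
          have := M.evHom.map_mono hn
          rw [BalHom.map_abs, BalHom.map_smul_one, smul_eq_mul, mul_one] at this
          exact abs_le.1 this)
      exact ⟨r, hr⟩
    choose φ hφ using key
    have uniq : ∀ (a : A) (r : ℝ),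
        Filter.Tendsto (fun M : Yosida A => M.val a) U (nhds r) → φ a = r :=
      fun a r h => tendsto_nhds_unique (hφ a) h
    let Φ : BalHom A ℝ :=
      { toFun := φ
        map_one' := uniq 1 1 (by
          simp only [← evHom_apply, map_one]
          exact tendsto_const_nhds)
        map_zero' := uniq 0 0 (by
          simp only [← evHom_apply, map_zero]
          exact tendsto_const_nhds)
        map_add' := fun a b => uniq _ _ (by
          simp only [← evHom_apply, map_add]
          exact (hφ a).add (hφ b))
        map_mul' := fun a b => uniq _ _ (by
          simp only [← evHom_apply, map_mul]
          exact (hφ a).mul (hφ b))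
        commutes' := fun r => uniq _ _ (by
          simp only [← evHom_apply, AlgHomClass.commutes]
          exact tendsto_const_nhds)
        map_sup' := fun a b => uniq _ _ (by
          simp only [← evHom_apply, map_sup]
          exact (hφ a).max (hφ b))
        map_inf' := fun a b => uniq _ _ (by
          simp only [← evHom_apply, map_inf]
          exact (hφ a).min (hφ b)) }
    refine ⟨ofHom Φ, trivial, le_nhds_iff.2 fun O hO hopen => ?_⟩
    obtain ⟨I, hI⟩ := isClosed_iff.1 hopen.isClosed_compl
    have hn : ¬ I.toIdeal ≤ (ofHom Φ).1.toIdeal := fun h => by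
      have : ofHom Φ ∈ Oᶜ := hI ▸ h
      exact this hO
    obtain ⟨a, ha, haΦ⟩ := Set.not_subset.1 hn
    have hne : φ a ≠ 0 := fun h => haΦ (mem_ofHom.2 h)
    have hev := (hφ a).eventually (isOpen_ne.mem_nhds hne)
    refine Filter.mem_of_superset hev fun M hM => ?_
    by_contra hMO
    have hMZ : M ∈ Z I := hI.symm ▸ hMO
    exact hM (val_eq_zero_iff.2 (hMZ ha))

end

/-- `Y(α) = α⁻¹` on points. -/
def comap {A B : BAL.{u}} (α : A ⟶ B) (M : Yosida B) : Yosida A where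
  val :=
    { toIdeal := M.1.toIdeal.comap α.hom
      solid := fun a b h hb => by
        rw [Ideal.mem_comap] at hb ⊢
        refine M.1.solid _ _ ?_ hb
        rw [← BalHom.map_abs, ← BalHom.map_abs]
        exact α.hom.map_mono h }
  property := by
    have h := (ofHom (M.evHom.comp α.hom)).2
    convert h using 1
    refine LIdeal.ext' (Ideal.ext fun a => ?_)
    exact val_eq_zero_iff.symm.trans (mem_ofHom (φ := M.evHom.comp α.hom)).symm

lemma mem_comap {A B : BAL.{u}} {α : A ⟶ B} {M : Yosida B} {a : A} :
    a ∈ (comap α M).1.toIdeal ↔ α.hom a ∈ M.1.toIdeal := Iff.rfl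

lemma continuous_comap {A B : BAL.{u}} (α : A ⟶ B) : Continuous (comap α) := by
  refine continuous_def.2 fun O hO => ?_
  obtain ⟨I, hI⟩ := isClosed_iff.1 hO.isClosed_compl
  have : comap α ⁻¹' O = ⋃ a ∈ I.toIdeal, {M : Yosida B | α.hom a ∉ M.1.toIdeal} := by
    ext M
    simp only [Set.mem_preimage, Set.mem_iUnion, Set.mem_ofPred_eq, exists_prop]
    rw [← not_iff_not, ← Set.mem_compl_iff, ← hI]
    push Not
    exact Iff.rfl
  rw [this]
  exact isOpen_biUnion fun a _ => isOpen_notMem _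

end Yosida

/-! ### The functors `Y` and `C` -/

/-- The contravariant functor `Y : BAL → KHaus`. -/
noncomputable def Y : BAL.{u}ᵒᵖ ⥤ CompHaus.{u} where
  obj A := CompHaus.of (Yosida A.unop)
  map f := CompHausLike.ofHom _ ⟨Yosida.comap f.unop, Yosida.continuous_comap f.unop⟩
  map_id _ := rfl
  map_comp _ _ := rfl

section CX

variable (X : Type u) [TopologicalSpace X] [CompactSpace X]

lemma exists_bound (f : C(X, ℝ)) : ∃ n : ℕ, ∀ x, |f x| ≤ n := by
  obtain ⟨c, hc⟩ := (isCompact_range f.continuous).isBounded.exists_norm_le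
  obtain ⟨n, hn⟩ := exists_nat_ge c
  exact ⟨n, fun x => (hc _ ⟨x, rfl⟩).trans hn⟩

instance : IsBal C(X, ℝ) where
  add_le_add_right' f g h hfg x := add_le_add_left (hfg x) (h x)
  mul_nonneg' f g hf hg x := mul_nonneg (hf x) (hg x)
  smul_nonneg' r f hr hf x := mul_nonneg hr (hf x)
  bounded f := by
    obtain ⟨n, hn⟩ := exists_bound X f
    refine ⟨n, fun x => ?_⟩
    have : (n • (1 : C(X, ℝ))) x = n := by simp
    change f x ≤ (n • (1 : C(X, ℝ))) x
    rw [this]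
    exact (le_abs_self _).trans (hn x)
  archimedean f g h x := by
    change f x ≤ 0
    by_contra hx
    push Not at hx
    obtain ⟨n, hn⟩ := Archimedean.arch (g x + 1) hx
    have h1 : n • f x ≤ g x := h n x
    linarith

lemma abs_le_smul_one_iff {f : C(X, ℝ)} {r : ℝ} :
    |f| ≤ r • (1 : C(X, ℝ)) ↔ ∀ x, |f x| ≤ r := by
  have e : ∀ x, (r • (1 : C(X, ℝ))) x = r := fun x => by simp
  constructor
  · intro h x
    have h1 : |f x| ≤ (r • (1 : C(X, ℝ))) x := h x
    rwa [e] at h1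
  · intro h x
    change |f x| ≤ (r • (1 : C(X, ℝ))) x
    rw [e]
    exact h x

/-- On `C(X)` the norm defined through the order is the supremum norm. -/
lemma lnorm_eq_norm (f : C(X, ℝ)) : lnorm f = ‖f‖ := by
  apply le_antisymm
  · exact lnorm_le_of IsBal.bounded (norm_nonneg f)
      ((abs_le_smul_one_iff X).2 fun x => f.norm_coe_le_norm x)
  · refine le_of_forall_gt_imp_ge_of_dense fun r hr => ?_
    have hr0 : 0 ≤ r := (lnorm_nonneg IsBal.bounded f).trans hr.le
    exact (ContinuousMap.norm_le f hr0).2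
      ((abs_le_smul_one_iff X).1 (abs_le_of_lnorm_lt IsBal.bounded hr))

lemma uniformlyComplete_CX : IsUniformlyComplete C(X, ℝ) := by
  intro s hs
  have hc : CauchySeq s := Metric.cauchySeq_iff.2 fun ε hε => by
    obtain ⟨N, hN⟩ := hs ε hε
    refine ⟨N, fun m hm n hn => ?_⟩
    rw [dist_eq_norm, ← lnorm_eq_norm]
    exact hN m hm n hn
  obtain ⟨f, hf⟩ := cauchySeq_tendsto_of_complete hc
  refine ⟨f, fun ε hε => ?_⟩
  obtain ⟨N, hN⟩ := Metric.tendsto_atTop.1 hf ε hε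
  refine ⟨N, fun n hn => ?_⟩
  rw [lnorm_eq_norm, ← dist_eq_norm]
  exact hN n hn

end CX

/-- `C(X)` as an object of `BAL`. -/
noncomputable def CObj (X : CompHaus.{u}) : BAL.{u} := { carrier := C(X, ℝ) }

/-- Precomposition `f ↦ f ∘ φ` with a continuous map. -/
def precomp {X Z : Type u} [TopologicalSpace X] [TopologicalSpace Z] (φ : C(X, Z)) :
    BalHom C(Z, ℝ) C(X, ℝ) :=
  { ContinuousMap.compRightAlgHom ℝ ℝ φ with
    map_sup' := fun _ _ => rfl
    map_inf' := fun _ _ => rfl }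

/-- `C` on morphisms. -/
noncomputable def CMap {X Z : CompHaus.{u}} (φ : X ⟶ Z) : CObj Z ⟶ CObj X :=
  ⟨precomp (ConcreteCategory.hom φ)⟩

/-- The contravariant functor `C : KHaus → BAL`, `X ↦ C(X)`, `φ ↦ (f ↦ f ∘ φ)`. -/
noncomputable def C : CompHaus.{u}ᵒᵖ ⥤ BAL.{u} where
  obj X := CObj X.unop
  map φ := CMap φ.unop
  map_id _ := rfl
  map_comp _ _ := rfl

/-- The covariant composite `CY : BAL → BAL`. -/
noncomputable def CY : BAL.{u} ⥤ BAL.{u} := Y.rightOp ⋙ C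

/-- The map `a ↦ (M ↦ r)`, where `r` is the unique real number with `a + M = r + M`. -/
noncomputable def zetaHom (A : Type u) [CommRing A] [Lattice A] [Algebra ℝ A] [IsBal A] :
    BalHom A C(Yosida A, ℝ) where
  toFun a := ⟨fun M => M.val a, Yosida.continuous_val a⟩
  map_one' := ContinuousMap.ext fun M => map_one M.evHom
  map_mul' a b := ContinuousMap.ext fun M => map_mul M.evHom a b
  map_zero' := ContinuousMap.ext fun M => map_zero M.evHom
  map_add' a b := ContinuousMap.ext fun M => map_add M.evHom a b
  commutes' r := ContinuousMap.ext fun M => AlgHomClass.commutes M.evHom r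
  map_sup' a b := ContinuousMap.ext fun M => map_sup M.evHom a b
  map_inf' a b := ContinuousMap.ext fun M => map_inf M.evHom a b

/-- The uniform completion `ζ_A : A → C(Y_A)`. -/
noncomputable def ζ (A : BAL.{u}) : A ⟶ CY.obj A := ⟨zetaHom A⟩

/-! ### Uniformly complete objects and algebras -/

/-- The uniformly complete objects of `BAL`. -/
def isUBAL : ObjectProperty BAL.{u} := fun A => IsUniformlyComplete A

/-- The full subcategory of uniformly complete bounded archimedean `ℓ`-algebras. -/
abbrev UBAL : Type (u + 1) := isUBAL.{u}.FullSubcategory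

lemma isUBAL_CY (A : BAL.{u}) : isUBAL (CY.obj A) :=
  uniformlyComplete_CX (Yosida A)

/-- The endofunctor `H^u = C ∘ Y ∘ H` of `UBAL`. -/
noncomputable def Hu : UBAL.{u} ⥤ UBAL.{u} :=
  isUBAL.lift (isUBAL.ι ⋙ H ⋙ CY) fun A => isUBAL_CY (H.obj A.obj)

/-- `Alg(H)`. -/
abbrev AlgH : Type (u + 1) := Endofunctor.Algebra H.{u}

/-- The algebras for `H` whose carrier is uniformly complete. -/
def isAlgu : ObjectProperty AlgH.{u} := fun X => isUBAL X.a

/-- `Alg^u(H)`, the full subcategory of `Alg(H)` on the algebras with uniformly complete carrier. -/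
abbrev AlguH : Type (u + 1) := isAlgu.{u}.FullSubcategory

/-- `Alg(H^u)`. -/
abbrev AlgHu : Type (u + 1) := Endofunctor.Algebra Hu.{u}

/-- The forgetful functor `Alg^u(H) → UBAL`, `(A, α) ↦ A`, `γ ↦ γ`. -/
noncomputable def forgetAlguH : AlguH.{u} ⥤ UBAL.{u} :=
  isUBAL.lift (isAlgu.ι ⋙ Endofunctor.Algebra.forget H) fun X => X.property

/-- The forgetful functor `Alg(H^u) → UBAL`, `(A, α) ↦ A`, `γ ↦ γ`. -/
noncomputable def forgetAlgHu : AlgHu.{u} ⥤ UBAL.{u} := Endofunctor.Algebra.forget Hu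

/-- The object `(A, α)` of `Alg^u(H)`. -/
noncomputable def AlguH.of (A : UBAL.{u}) (α : H.obj A.obj ⟶ A.obj) : AlguH.{u} :=
  ⟨⟨A.obj, α⟩, A.property⟩

/-- The object `(A, β)` of `Alg(H^u)`, for a morphism `β : C(Y_{H(A)}) → A`. -/
noncomputable def AlgHu.of (A : UBAL.{u}) (β : CY.obj (H.obj A.obj) ⟶ A.obj) : AlgHu.{u} :=
  ⟨A, ObjectProperty.homMk β⟩

end Bal

/-! The statement is a formal consequence of the fact that `ζ B` reflects `B` into the uniformly
complete objects: a morphism from `B` to a uniformly complete `A` extends along `ζ B` to `C(Y_B)` in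
exactly one way.

Uniqueness (`BalHom.ext_zetaHom`, `CY_hom_ext`): the image of `ζ B` is dense and every morphism is
norm-decreasing, so two morphisms that agree on the image agree everywhere. The target need not be
complete here.

Existence (`ζ_extend`): `ζ` is natural, and `ζ A` is bijective for complete `A`, so the extension of
`α` is `CY(α)` followed by the inverse of `ζ A`. Bijectivity is the analytic core. By Zorn's lemma
and the archimedean property, the maximal `ℓ`-ideals determine the order
(`nonpos_of_forall_val_nonpos`), so `ζ A` is injective and isometric. It has dense range by
Stone–Weierstrass, and a dense isometric image of a complete algebra is everything
(`zetaHom_surjective`).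

With `B = H(A)`, composition with `ζ` is a bijection between structure maps `C(Y_{H(A)}) → A` and
structure maps `H(A) → A`. The squares defining algebra morphisms correspond as well: one direction
is naturality of `ζ` (`ζ_comp_comm`), the other adds uniqueness of extensions (`extend_comm`). Of
`H` only functoriality enters, so its generators and relations play no role. -/

namespace Bal

/-! ### Maximal `ℓ`-ideals determine the order. -/

section Separation

variable {A : Type*} [CommRing A] [Lattice A]

/-- A proper `ℓ`-ideal lies in a maximal `ℓ`-ideal. -/
lemma LIdeal.exists_yosida_ge (I : LIdeal A) (hI : I.toIdeal ≠ ⊤) :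
    ∃ M : Yosida A, I.toIdeal ≤ M.1.toIdeal := by
  -- Zorn's lemma runs over ring ideals ordered by inclusion, with solidity as a side condition; the
  -- `ℓ`-ideal is bundled only at the end.
  obtain ⟨J, hIJ, hJ, hmax⟩ := zorn_le_nonempty₀
    {J : Ideal A | J ≠ ⊤ ∧ ∀ a b : A, |a| ≤ |b| → b ∈ J → a ∈ J}
    (fun c hcS hchain J₀ hJ₀ => by
      -- The supremum of a nonempty chain of ideals is its union. Properness, tested on `1`, and
      -- solidity therefore pass to it from the members.
      have hmem : ∀ x, x ∈ sSup c ↔ ∃ J ∈ c, x ∈ J := fun x =>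
        Submodule.mem_sSup_of_directed ⟨J₀, hJ₀⟩ hchain.directedOn
      refine ⟨sSup c, ⟨fun htop => ?_, fun a b hab hb => ?_⟩, fun J hJ => le_sSup hJ⟩
      · obtain ⟨J, hJ, h1⟩ := (hmem 1).1 (htop ▸ Submodule.mem_top)
        exact (hcS hJ).1 ((Ideal.eq_top_iff_one J).2 h1)
      · obtain ⟨J, hJ, hbJ⟩ := (hmem b).1 hb
        exact (hmem a).2 ⟨J, hJ, (hcS hJ).2 a b hab hbJ⟩)
    I.toIdeal ⟨hI, I.solid⟩
  exact ⟨⟨⟨J, hJ.2⟩, hJ.1, fun K hK hle =>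
    LIdeal.ext' (le_antisymm (hmax ⟨hK, K.solid⟩ hle) hle)⟩, hIJ⟩

variable [Algebra ℝ A] [IsBal A]

/-- The `ℓ`-ideal of elements dominated in absolute value by a nonnegative multiple of `c`. -/
def LIdeal.principal (c : A) : LIdeal A where
  toIdeal :=
    { carrier := {z | ∃ r : ℝ, 0 ≤ r ∧ |z| ≤ r • c}
      zero_mem' := ⟨0, le_rfl, by simp [abs]⟩
      add_mem' := by
        rintro a b ⟨r, hr, h⟩ ⟨s, hs, h'⟩
        refine ⟨r + s, add_nonneg hr hs, ?_⟩
        rw [add_smul]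
        exact (abs_add_le a b).trans (add_le_add h h')
      smul_mem' := by
        rintro x a ⟨r, hr, h⟩
        -- Boundedness makes the set closed under multiplication by `x`: from `|x| ≤ k` follows `|x
        -- * a| ≤ k • |a|`, so real multiples of `c` suffice as bounds.
        obtain ⟨k, hk⟩ := IsBal.bounded |x|
        have hk0 : (0 : ℝ) ≤ k := k.cast_nonneg
        refine ⟨k * r, mul_nonneg hk0 hr, (abs_mul_le x a).trans ?_⟩
        have h1 : |x| * |a| ≤ (k : ℝ) • |a| := by
          rw [nsmul_one_eq] at hk
          refine sub_nonneg.1 ((mul_nn (sub_nonneg.2 hk) (abs_nonneg a)).trans_eq ?_)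
          rw [sub_mul, smul_mul_assoc, one_mul]
        rw [mul_smul]
        exact h1.trans (smul_mono hk0 h) }
  solid := by
    rintro a b h ⟨r, hr, h'⟩
    exact ⟨r, hr, h.trans h'⟩

/-- If a nonnegative `c` dominates a positive multiple of `1`, only `0` is disjoint from `c`. -/
lemma eq_zero_of_inf_eq_zero {c d : A} (hc : 0 ≤ c) (hd : 0 ≤ d) (h : c ⊓ d = 0) {r : ℝ}
    (hr : 0 ≤ r) (h1 : 1 ≤ r • c) : d = 0 := by
  obtain ⟨m, hm⟩ := IsBal.bounded d
  rw [nsmul_one_eq] at hm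
  have hm0 : (0 : ℝ) ≤ m := m.cast_nonneg
  -- With `t = m * r + 1`, both `d ≤ t • c` and `d ≤ t • d` hold: the first because `d ≤ m • 1 ≤ (m
  -- * r) • c`, the second because `t ≥ 1`. Hence `t⁻¹ • d ≤ c ⊓ d = 0`. The summand `1` also makes
  -- `t` invertible when `m * r = 0`.
  have ht : 0 < m * r + 1 := by positivity
  have hdc : d ≤ ((m : ℝ) * r + 1) • c := by
    rw [add_smul, mul_smul, one_smul]
    exact (hm.trans (smul_mono hm0 h1)).trans (le_add_of_nonneg_right hc)
  have hdd : d ≤ ((m : ℝ) * r + 1) • d := by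
    rw [add_smul, one_smul]
    exact le_add_of_nonneg_left (smul_nn (by positivity) hd)
  have hinf : ((m : ℝ) * r + 1)⁻¹ • d ≤ c ⊓ d := by
    refine le_inf ?_ ?_
    · have := smul_mono (inv_nonneg.2 ht.le) hdc
      rwa [smul_smul, inv_mul_cancel₀ ht.ne', one_smul] at this
    · have := smul_mono (inv_nonneg.2 ht.le) hdd
      rwa [smul_smul, inv_mul_cancel₀ ht.ne', one_smul] at this
  have := smul_mono ht.le (hinf.trans_eq h)
  rw [smul_smul, mul_inv_cancel₀ ht.ne', one_smul, smul_zero] at this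
  exact le_antisymm this hd

/-- The order of a bounded archimedean `ℓ`-algebra is determined by its values on `Y_A`. -/
lemma nonpos_of_forall_val_nonpos {a : A} (h : ∀ M : Yosida A, M.val a ≤ 0) : a ≤ 0 := by
  -- It suffices that `n • a ≤ 1` for every `n`. If this fails for some `n`, the positive part of `1
  -- - n • a` generates a proper `ℓ`-ideal, and a maximal `ℓ`-ideal above it is a point where `n •
  -- a` has value at least `1`.
  refine IsBal.archimedean a 1 fun n => ?_
  by_contra hn
  have hproper : (LIdeal.principal ((1 - n • a) ⊔ 0)).toIdeal ≠ ⊤ := fun htop => by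
    obtain ⟨r, hr, h1⟩ := (Ideal.eq_top_iff_one _).1 htop
    -- Were the ideal improper, its generator would dominate a positive multiple of `1`. The
    -- negative part of `1 - n • a`, being disjoint from it, would vanish, which says `n • a ≤ 1`.
    have hdisj : ((1 - n • a) ⊔ 0) ⊓ ((n • a - 1) ⊔ 0) = 0 := by
      rw [← neg_sub 1 (n • a)]
      exact posPart_inf_negPart_eq_zero (1 - n • a)
    have hzero := eq_zero_of_inf_eq_zero le_sup_right le_sup_right hdisj hr
      ((le_abs_self 1).trans h1)
    exact hn (sub_nonpos.1 (sup_eq_right.1 hzero))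
  obtain ⟨M, hM⟩ := LIdeal.exists_yosida_ge _ hproper
  have hmem : (1 - n • a) ⊔ 0 ∈ M.1.toIdeal :=
    hM ⟨1, zero_le_one, by rw [one_smul, abs_of_nonneg le_sup_right]⟩
  -- Evaluation at `M` turns the membership into `1 ≤ n * M.val a`, whereas the hypothesis makes the
  -- right side nonpositive.
  rw [← Yosida.val_eq_zero_iff, ← Yosida.evHom_apply, map_sup, map_sub, map_one, map_zero,
    map_nsmul, sup_eq_right, sub_nonpos, Yosida.evHom_apply, nsmul_eq_mul] at hmem
  have := mul_nonpos_of_nonneg_of_nonpos (Nat.cast_nonneg (α := ℝ) n) (h M)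
  linarith

/-- Norm zero makes `|a|` infinitesimal: all its multiples stay below `1`, and the archimedean
property excludes this unless `|a| ≤ 0`. -/
lemma eq_zero_of_lnorm_eq_zero {a : A} (h : lnorm a = 0) : a = 0 := by
  have hle : ∀ n : ℕ, n • |a| ≤ (1 : A) := fun n => by
    -- The bound `(n + 1)⁻¹` is positive even for `n = 0`, and `n * (n + 1)⁻¹ ≤ 1`.
    have h1 : |a| ≤ ((n : ℝ) + 1)⁻¹ • (1 : A) :=
      abs_le_of_lnorm_lt IsBal.bounded (h ▸ by positivity)
    have h2 := smul_mono (Nat.cast_nonneg (α := ℝ) n) h1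
    rw [smul_smul, Nat.cast_smul_eq_nsmul] at h2
    refine (h2.trans (smul_one_mono IsBal.bounded (s := 1) ?_)).trans_eq (one_smul ℝ 1)
    rw [← div_eq_mul_inv, div_le_one (by positivity)]
    linarith
  have h0 : |a| ≤ 0 := IsBal.archimedean _ _ hle
  exact le_antisymm ((le_abs_self a).trans h0) (neg_nonpos.1 ((neg_le_abs a).trans h0))

end Separation

/-! ### Uniform completion: isometry, density, and surjectivity in the complete case. -/

section Completion

variable {A : Type u} [CommRing A] [Lattice A] [Algebra ℝ A] [IsBal A]

lemma zetaHom_apply (a : A) (M : Yosida A) : zetaHom A a M = M.val a := rfl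

lemma le_of_zetaHom_le {a b : A} (h : zetaHom A a ≤ zetaHom A b) : a ≤ b := by
  refine sub_nonpos.1 (nonpos_of_forall_val_nonpos fun M => ?_)
  rw [← Yosida.evHom_apply, map_sub, sub_nonpos]
  exact h M

lemma zetaHom_injective : Function.Injective (zetaHom A) := fun _ _ h =>
  le_antisymm (le_of_zetaHom_le h.le) (le_of_zetaHom_le h.ge)

/-- One inequality holds for any morphism. The other comes from order reflection: a bound `|ζ a| ≤
r` in `C(Y_A)` pulls back to `|a| ≤ r` in `A`. -/
lemma norm_zetaHom (a : A) : ‖zetaHom A a‖ = lnorm a := by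
  rw [← lnorm_eq_norm]
  refine le_antisymm ((zetaHom A).lnorm_map_le IsBal.bounded IsBal.bounded a) ?_
  refine le_of_forall_gt_imp_ge_of_dense fun r hr => ?_
  refine lnorm_le_of IsBal.bounded ((lnorm_nonneg IsBal.bounded _).trans hr.le) ?_
  apply le_of_zetaHom_le
  rw [BalHom.map_abs, BalHom.map_smul_one]
  exact abs_le_of_lnorm_lt IsBal.bounded hr

/-- Stone–Weierstrass: the image is a real subalgebra of `C(Y_A)` that separates the points of the
compact space `Y_A`. -/
lemma denseRange_zetaHom : DenseRange (zetaHom A) := by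
  have hsep : (zetaHom A).toAlgHom.range.SeparatesPoints := fun M N hne => by
    -- By maximality `M` is not contained in `N`. An element of `M` outside `N` has value zero at
    -- `M` and nonzero value at `N`.
    obtain ⟨a, ha, haN⟩ := Set.not_subset.1 fun h => hne (Yosida.eq_of_le h)
    refine ⟨zetaHom A a, ⟨zetaHom A a, ⟨a, rfl⟩, rfl⟩, ?_⟩
    rw [zetaHom_apply, zetaHom_apply, Yosida.val_eq_zero_iff.2 ha]
    exact fun h => haN (Yosida.val_eq_zero_iff.1 h.symm)
  have htop := ContinuousMap.subalgebra_topologicalClosure_eq_top_of_separatesPoints _ hsep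
  intro f
  have hf : f ∈ (zetaHom A).toAlgHom.range.topologicalClosure := htop ▸ Algebra.mem_top
  exact hf

/-- A function `f` is a limit of images `ζ (t n)`. As `ζ` is isometric, `t` is Cauchy in `A`; the
image of its limit is again a limit of the `ζ (t n)`, hence equals `f`. -/
lemma zetaHom_surjective (hA : IsUniformlyComplete A) : Function.Surjective (zetaHom A) := by
  intro f
  obtain ⟨s, hs, hlim⟩ := mem_closure_iff_seq_limit.1 (denseRange_zetaHom f)
  choose t ht using hs
  have hdist : ∀ m n, dist (s m) (s n) = lnorm (t m - t n) := fun m n => by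
    rw [dist_eq_norm, ← norm_zetaHom, map_sub, ht, ht]
  obtain ⟨a, ha⟩ := hA t fun ε hε => by
    obtain ⟨N, hN⟩ := Metric.cauchySeq_iff.1 hlim.cauchySeq ε hε
    exact ⟨N, fun m hm n hn => hdist m n ▸ hN m hm n hn⟩
  refine ⟨a, tendsto_nhds_unique (Metric.tendsto_atTop.2 fun ε hε => ?_) hlim⟩
  obtain ⟨N, hN⟩ := ha ε hε
  refine ⟨N, fun n hn => ?_⟩
  rw [dist_eq_norm, ← ht, ← map_sub, norm_zetaHom]
  exact hN n hn

/-- Morphisms out of `C(Y_A)` are determined by their values on `A`. -/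
lemma BalHom.ext_zetaHom {B : Type*} [CommRing B] [Lattice B] [Algebra ℝ B] [IsBal B]
    {f g : BalHom C(Yosida A, ℝ) B} (h : ∀ a, f (zetaHom A a) = g (zetaHom A a)) : f = g := by
  refine BalHom.ext fun x => sub_eq_zero.1 (eq_zero_of_lnorm_eq_zero ?_)
  refine le_antisymm (le_of_forall_pos_le_add fun ε hε => ?_) (lnorm_nonneg IsBal.bounded _)
  -- Half of `ε` is allotted to each of `f` and `g`, since neither increases the norm of `x - ζ a`;
  -- the values at `ζ a` itself cancel by hypothesis.
  obtain ⟨a, ha⟩ := denseRange_zetaHom.exists_dist_lt x (half_pos hε)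
  rw [dist_eq_norm, ← lnorm_eq_norm] at ha
  have hbound : ∀ k : BalHom C(Yosida A, ℝ) B, |k (x - zetaHom A a)| ≤ (ε / 2) • (1 : B) :=
    fun k => abs_le_of_lnorm_lt IsBal.bounded
      ((k.lnorm_map_le IsBal.bounded IsBal.bounded _).trans_lt ha)
  refine lnorm_le_of IsBal.bounded (by linarith) ?_
  have e : f x - g x = f (x - zetaHom A a) + -g (x - zetaHom A a) := by
    rw [map_sub, map_sub, h]
    abel
  rw [e]
  refine (abs_add_le _ _).trans ((add_le_add (hbound f) ((abs_neg _).trans_le (hbound g))).trans_eq ?_)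
  rw [← add_smul, add_halves, zero_add]

/-- The inverse of a bijective morphism. -/
noncomputable def BalHom.inverse {B C : Type*} [CommRing B] [Lattice B] [Algebra ℝ B]
    [CommRing C] [Lattice C] [Algebra ℝ C] (f : BalHom B C) (hf : Function.Bijective f) :
    BalHom C B :=
  { (AlgEquiv.ofBijective f.toAlgHom hf).symm.toAlgHom with
    map_sup' := fun x y => by
      obtain ⟨a, rfl⟩ := hf.2 x
      obtain ⟨b, rfl⟩ := hf.2 y
      change (AlgEquiv.ofBijective f.toAlgHom hf).symm (f a ⊔ f b) =
        (AlgEquiv.ofBijective f.toAlgHom hf).symm (f a) ⊔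
          (AlgEquiv.ofBijective f.toAlgHom hf).symm (f b)
      have e : ∀ c, (AlgEquiv.ofBijective f.toAlgHom hf).symm (f c) = c :=
        (AlgEquiv.ofBijective f.toAlgHom hf).symm_apply_apply
      rw [← map_sup, e, e, e]
    map_inf' := fun x y => by
      obtain ⟨a, rfl⟩ := hf.2 x
      obtain ⟨b, rfl⟩ := hf.2 y
      change (AlgEquiv.ofBijective f.toAlgHom hf).symm (f a ⊓ f b) =
        (AlgEquiv.ofBijective f.toAlgHom hf).symm (f a) ⊓
          (AlgEquiv.ofBijective f.toAlgHom hf).symm (f b)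
      have e : ∀ c, (AlgEquiv.ofBijective f.toAlgHom hf).symm (f c) = c :=
        (AlgEquiv.ofBijective f.toAlgHom hf).symm_apply_apply
      rw [← map_inf, e, e, e] }

lemma BalHom.inverse_apply {B C : Type*} [CommRing B] [Lattice B] [Algebra ℝ B]
    [CommRing C] [Lattice C] [Algebra ℝ C] (f : BalHom B C) (hf : Function.Bijective f) (b : B) :
    f.inverse hf (f b) = b :=
  (AlgEquiv.ofBijective f.toAlgHom hf).symm_apply_apply b

end Completion

/-! ### Naturality of `ζ` and unique extension along it. -/

/-- For real `r`, `a - r` lies in the preimage of `M` under `α` exactly when `α(a) - r` lies in `M`,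
so `a` and `α(a)` have the same value at the corresponding points. -/
lemma ζ_naturality {A B : BAL.{u}} (α : A ⟶ B) : α ≫ ζ B = ζ A ≫ CY.map α := by
  refine BAL.hom_ext fun a => ContinuousMap.ext fun M => ?_
  change M.val (α.hom a) = (Yosida.comap α M).val a
  refine (Yosida.val_eq_iff.2 ?_).symm
  change α.hom (a - Yosida.val (A := B) M (α.hom a) • (1 : A)) ∈ M.1.toIdeal
  rw [map_sub, BalHom.map_smul_one]
  exact Yosida.val_mem (A := B) M _

/-- The extension of a morphism into a uniformly complete object along the uniform completion. -/
noncomputable def extend {B A : BAL.{u}} (hA : isUBAL A) (α : B ⟶ A) :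
    CY.obj B ⟶ A :=
  CY.map α ≫ ⟨(zetaHom A).inverse ⟨zetaHom_injective, zetaHom_surjective hA⟩⟩

lemma ζ_extend {B A : BAL.{u}} (hA : isUBAL A) (α : B ⟶ A) :
    ζ B ≫ extend hA α = α := by
  rw [extend, ← Category.assoc, ← ζ_naturality]
  exact BAL.hom_ext fun b =>
    (zetaHom A).inverse_apply ⟨zetaHom_injective, zetaHom_surjective hA⟩ (α.hom b)

lemma CY_hom_ext {B A : BAL.{u}} {f g : CY.obj B ⟶ A} (h : ζ B ≫ f = ζ B ≫ g) : f = g :=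
  BAL.Hom.ext (BalHom.ext_zetaHom fun b => congrArg (fun k : B ⟶ A => k.hom b) h)

/-- Both sides restrict along `ζ B` to the same morphism, so uniqueness identifies them. This is one
of the two round trips on structure maps; `ζ_extend` is the other. -/
lemma extend_ζ {B A : BAL.{u}} (hA : isUBAL A) (β : CY.obj B ⟶ A) :
    extend hA (ζ B ≫ β) = β :=
  CY_hom_ext (ζ_extend hA _)

/-- Passing to extensions keeps algebra squares commutative: by naturality, restriction along `ζ B`
gives back the original square, and restriction loses nothing. -/
lemma extend_comm {B B' A A' : BAL.{u}} (hA : isUBAL A) (hA' : isUBAL A') {φ : B ⟶ B'}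
    {α : B ⟶ A} {α' : B' ⟶ A'} {γ : A ⟶ A'} (h : φ ≫ α' = α ≫ γ) :
    CY.map φ ≫ extend hA' α' = extend hA α ≫ γ := by
  refine CY_hom_ext ?_
  rw [← Category.assoc, ← ζ_naturality, Category.assoc, ζ_extend, ← Category.assoc, ζ_extend, h]

lemma ζ_comp_comm {B B' A A' : BAL.{u}} {φ : B ⟶ B'} {β : CY.obj B ⟶ A} {β' : CY.obj B' ⟶ A'}
    {γ : A ⟶ A'} (h : CY.map φ ≫ β' = β ≫ γ) : φ ≫ ζ B' ≫ β' = (ζ B ≫ β) ≫ γ := by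
  rw [← Category.assoc, ζ_naturality, Category.assoc, h, Category.assoc]

/-! ### The two functors and their composites. -/

/-- The functor `Alg^u(H) → Alg(H^u)`, `(A, α) ↦ (A, α^u)`. -/
noncomputable def toAlgHu : AlguH.{u} ⥤ AlgHu.{u} where
  obj X := AlgHu.of ⟨X.obj.a, X.property⟩ (extend X.property X.obj.str)
  map {X X'} γ :=
    { f := ObjectProperty.homMk γ.hom.f
      h := ObjectProperty.hom_ext _ (extend_comm X.property X'.property γ.hom.h) }
  map_id _ := rfl
  map_comp _ _ := rfl

/-- The functor `Alg(H^u) → Alg^u(H)`, `(A, β) ↦ (A, β ∘ ζ_{H(A)})`. -/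
noncomputable def toAlguH : AlgHu.{u} ⥤ AlguH.{u} where
  obj X := AlguH.of X.a (ζ (H.obj X.a.obj) ≫ X.str.hom)
  map γ := ObjectProperty.homMk
    { f := γ.f.hom
      h := ζ_comp_comm (congrArg (fun k => k.hom) γ.h) }
  map_id _ := rfl
  map_comp _ _ := rfl

/-- The round trips return structure maps that are equal but not definitionally so, which places a
morphism and its image in different hom-types. Substituting the equalities reduces the comparison to
underlying morphisms. -/
lemma AlguH.heq_of_hom_eq {A B : UBAL.{u}} {α α' : H.obj A.obj ⟶ A.obj}
    {β β' : H.obj B.obj ⟶ B.obj} (hα : α = α') (hβ : β = β')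
    {f : AlguH.of A α ⟶ AlguH.of B β} {g : AlguH.of A α' ⟶ AlguH.of B β'}
    (h : f.hom.f = g.hom.f) : HEq f g := by
  subst hα hβ
  exact heq_of_eq (ObjectProperty.hom_ext _ (Endofunctor.Algebra.Hom.ext h))

lemma AlgHu.heq_of_hom_eq {A B : UBAL.{u}} {α α' : CY.obj (H.obj A.obj) ⟶ A.obj}
    {β β' : CY.obj (H.obj B.obj) ⟶ B.obj} (hα : α = α') (hβ : β = β')
    {f : AlgHu.of A α ⟶ AlgHu.of B β} {g : AlgHu.of A α' ⟶ AlgHu.of B β'}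
    (h : f.f = g.f) : HEq f g := by
  subst hα hβ
  exact heq_of_eq (Endofunctor.Algebra.Hom.ext h)

lemma toAlgHu_comp_toAlguH : toAlgHu.{u} ⋙ toAlguH = 𝟭 AlguH.{u} :=
  Functor.hext
    (fun X => congrArg (AlguH.of ⟨X.obj.a, X.property⟩) (ζ_extend X.property X.obj.str))
    fun X X' γ => AlguH.heq_of_hom_eq (A := ⟨X.obj.a, X.property⟩) (B := ⟨X'.obj.a, X'.property⟩)
      -- Both functors leave the underlying morphism untouched, hence the final `rfl`.
      (ζ_extend X.property X.obj.str) (ζ_extend X'.property X'.obj.str) (g := γ) rfl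

lemma toAlguH_comp_toAlgHu : toAlguH.{u} ⋙ toAlgHu = 𝟭 AlgHu.{u} :=
  Functor.hext
    (fun X => congrArg (AlgHu.of X.a) (extend_ζ X.a.property X.str.hom))
    fun X X' γ => AlgHu.heq_of_hom_eq (A := X.a) (B := X'.a)
      (extend_ζ X.a.property X.str.hom) (extend_ζ X'.a.property X'.str.hom) (g := γ) rfl

end Bal

/-- The two equations with forgetful functors express that `F` and `G` keep the carrier and send
each `γ` to itself. The action on structure maps is recorded by the last two clauses, the former
with `αu` pinned down as the unique extension of `α`. -/
theorem mainTheorem5 :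
    ∃ (F : Bal.AlguH.{u} ⥤ Bal.AlgHu.{u}) (G : Bal.AlgHu.{u} ⥤ Bal.AlguH.{u}),
      F ⋙ G = 𝟭 Bal.AlguH.{u} ∧
      G ⋙ F = 𝟭 Bal.AlgHu.{u} ∧
      F ⋙ Bal.forgetAlgHu = Bal.forgetAlguH ∧
      G ⋙ Bal.forgetAlguH = Bal.forgetAlgHu ∧
      (∀ (A : Bal.UBAL.{u}) (α : Bal.H.obj A.obj ⟶ A.obj),
        ∃ αu : Bal.CY.obj (Bal.H.obj A.obj) ⟶ A.obj,
          Bal.ζ (Bal.H.obj A.obj) ≫ αu = α ∧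
          (∀ β : Bal.CY.obj (Bal.H.obj A.obj) ⟶ A.obj,
            Bal.ζ (Bal.H.obj A.obj) ≫ β = α → β = αu) ∧
          F.obj (Bal.AlguH.of A α) = Bal.AlgHu.of A αu) ∧
      (∀ (A : Bal.UBAL.{u}) (β : Bal.CY.obj (Bal.H.obj A.obj) ⟶ A.obj),
        G.obj (Bal.AlgHu.of A β) = Bal.AlguH.of A (Bal.ζ (Bal.H.obj A.obj) ≫ β)) :=
  ⟨Bal.toAlgHu, Bal.toAlguH, Bal.toAlgHu_comp_toAlguH, Bal.toAlguH_comp_toAlgHu, rfl, rfl,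
    fun A α => ⟨Bal.extend A.property α, Bal.ζ_extend A.property α,
      fun _ hβ => Bal.CY_hom_ext (hβ.trans (Bal.ζ_extend A.property α).symm), rfl⟩,
    fun _ _ => rfl⟩
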